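/- Let $L$ be the Fourier multiplier operator on $2\pi$-periodic functions, $\widehat{Lf}(k)=m(k)\hat f(k)$ with $\hat f(k)=\frac1{2\pi}\int_{-\pi}^{\pi}f(x)e^{-ikx}\,dx$, whose symbol $m:\mathbb Z\to\mathbb R$ is even and satisfies one of the following, where $\Delta m(k)=m(k+1)-m(k)$. (S) For some $r<0$ and every $n\ge 0$ there is $C_n$ with $|\Delta^n m(k)|\le C_n(1+|k|)^{r-n}$ for all $k\in\mathbb Z$; and $m$ has an extension to $\mathbb R$, still denoted $m$, for which the sequence $n_k=m(\sqrt k)$, $k=1,2,3,\dots$, is completely monotone, i.e. $(-1)^j\Delta^j n_k\ge 0$ for all $j\ge 0$, $k\ge 1$. (H) For some $r<0$, $m$ is homogeneous of degree $r$ on $\mathbb Z\setminus\{0\}$, i.e. $m(nk)=n^r m(k)$ for all integers $n\ge1$ and $k\ne0$, and there are $a,b>0$ with $a|k|^r\le m(k)\le b|k|^r$ for all $k\neq 0$ (that is, $m(k)=m(1)|k|^r$ with $m(1)>0$). Let $c>0$ and let $\varphi:\mathbb R\to\mathbb R$ be $2\pi$-periodic and bounded (in $L^\infty$ of a period), and suppose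 that, almost everywhere, $$-c\varphi+L\varphi+\varphi^2=B,$$ where $B=0$ in case (S), and where, in case (H), $\varphi$ has zero mean and $B=\frac1{2\pi}\int_{-\pi}^{\pi}\varphi^2\,dx$. Assume that $\varphi$ is even, is nontrivial (not almost everywhere equal to a constant), and has a single crest per period, i.e. there are $x_0<x_1<x_0+2\pi$ such that $\varphi$ is nonincreasing on $[x_0,x_1]$ and nondecreasing on $[x_1,x_0+2\pi]$. If $\max\varphi=\frac c2$, then $\varphi$ does not belong to $C^1(\mathbb T)$. More precisely, the crest is not smooth: $\varphi$ is not continuously differentiable in any neighbourhood of a point $x$ with $\varphi(x)=\frac c2$. -/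

import Mathlib

open MeasureTheory Set

noncomputable section

namespace SteadyWave

/-- The `k`-th Fourier coefficient `(2π)⁻¹ ∫_{-π}^{π} f(x) e^{-ikx} dx` of a `2π`-periodic
real function. -/
def fourierHat (f : ℝ → ℝ) (k : ℤ) : ℂ :=
  fourierCoeffOn (neg_lt_self Real.pi_pos) (fun x => (f x : ℂ)) k

theorem fourierHat_eq (f : ℝ → ℝ) (k : ℤ) :
    fourierHat f k =
      (1 / (2 * Real.pi) : ℂ) *
        ∫ x in (-Real.pi)..Real.pi, (f x : ℂ) * Complex.exp (-Complex.I * x * k) := by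
  have h2 : (Real.pi : ℂ) ≠ 0 := by exact_mod_cast Real.pi_ne_zero
  rw [fourierHat, fourierCoeffOn_eq_integral, Complex.real_smul]
  have h : ∀ x : ℝ, (fourier (-k) (x : AddCircle (Real.pi - -Real.pi)) : ℂ) • (f x : ℂ) =
      (f x : ℂ) * Complex.exp (-Complex.I * x * k) := by
    intro x
    rw [fourier_coe_apply, smul_eq_mul, mul_comm]
    congr 2
    push_cast
    field_simp
    ring
  simp_rw [h]
  congr 1
  push_cast
  ring

/-- The class `S^r(ℤ)`: `|Δⁿ m(k)| ≤ Cₙ (1 + |k|)^(r - n)` for all `k ∈ ℤ` and all `n ≥ 0`,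
with `Δ m(k) = m(k + 1) - m(k)`. -/
def IsSymbolOfOrder (r : ℝ) (m : ℤ → ℝ) : Prop :=
  ∀ n : ℕ, ∃ C : ℝ, ∀ k : ℤ, |(fwdDiff (1 : ℤ))^[n] m k| ≤ C * (1 + |(k : ℝ)|) ^ (r - n)

/-- Completely monotone sequences: `(-1)ⁿ Δⁿ a(k) ≥ 0` for all `n, k ≥ 0`
(the case `n = 0` says that the terms are nonnegative). -/
def IsCompletelyMonotone (a : ℕ → ℝ) : Prop :=
  ∀ n k : ℕ, 0 ≤ (-1 : ℝ) ^ n * (fwdDiff (1 : ℕ))^[n] a k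

/-- Assumption (S): `m ∈ S^r(ℤ)` for some `r < 0`, and the sequence `(m(√k))` over `k = 1, 2, …`
is completely monotone. The values at the non-integers `√k` are those of an extension `M` of `m`
to the real line. -/
def AssumptionS (m : ℤ → ℝ) : Prop :=
  ∃ r : ℝ, r < 0 ∧ IsSymbolOfOrder r m ∧
    ∃ M : ℝ → ℝ, (∀ k : ℤ, M k = m k) ∧
      IsCompletelyMonotone (fun j : ℕ => M (Real.sqrt ((j + 1 : ℕ) : ℝ)))

/-- Assumption (H): on `ℤ \ {0}`, `m` is homogeneous of some degree `r < 0`, and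
`m(k)` is bounded above and below by positive multiples of `|k|^r`. -/
def AssumptionH (m : ℤ → ℝ) : Prop :=
  ∃ r : ℝ, r < 0 ∧
    (∀ n : ℕ, 0 < n → ∀ k : ℤ, k ≠ 0 → m (n * k) = (n : ℝ) ^ r * m k) ∧
    ∃ a b : ℝ, 0 < a ∧ 0 < b ∧
      ∀ k : ℤ, k ≠ 0 → a * |(k : ℝ)| ^ r ≤ m k ∧ m k ≤ b * |(k : ℝ)| ^ r

/-- `g = L f` for the Fourier multiplier operator `L` with symbol `m`: `g` is a `2π`-periodic
function, integrable over a period, with Fourier coefficients `ĝ(k) = m(k) f̂(k)`.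
If `f` has zero mean, then so has `g`, and the value `m(0)` plays no role. -/
def IsMultiplierImage (m : ℤ → ℝ) (f g : ℝ → ℝ) : Prop :=
  Function.Periodic g (2 * Real.pi) ∧
  IntervalIntegrable g volume (-Real.pi) Real.pi ∧
  ∀ k : ℤ, fourierHat g k = (m k : ℂ) * fourierHat f k

/-- `φ ∈ L^∞(𝕋)` is a (`2π`-periodic) bounded solution of `-c φ + L φ + φ² = B`. -/
def IsBoundedSolution (m : ℤ → ℝ) (c B : ℝ) (φ : ℝ → ℝ) : Prop :=
  Function.Periodic φ (2 * Real.pi) ∧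
  MemLp φ ⊤ (volume.restrict (Ioc (-Real.pi) Real.pi)) ∧
  ∃ Lφ : ℝ → ℝ, IsMultiplierImage m φ Lφ ∧
    ∀ᵐ x : ℝ, -c * φ x + Lφ x + φ x ^ 2 = B

/-- The mean `(2π)⁻¹ ∫_{-π}^{π} f` of a `2π`-periodic function. -/
def mean (f : ℝ → ℝ) : ℝ := (2 * Real.pi)⁻¹ * ∫ x in (-Real.pi)..Real.pi, f x

/-- A `2π`-periodic profile with a single crest per period: for some crest `x₀` and some
trough `x₁` between the crests `x₀` and `x₀ + 2π`, the profile does not increase from `x₀` to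
`x₁` and does not decrease from `x₁` to `x₀ + 2π`. -/
def HasSingleCrest (φ : ℝ → ℝ) : Prop :=
  ∃ x₀ x₁ : ℝ, x₀ < x₁ ∧ x₁ < x₀ + 2 * Real.pi ∧
    AntitoneOn φ (Icc x₀ x₁) ∧ MonotoneOn φ (Icc x₁ (x₀ + 2 * Real.pi))

end SteadyWave

end

/-! Completing the square turns the equation into `L φ = B + c²/4 - (c/2 - φ)²`. An even profile
with one crest is `M (cos (x - κ))` with `M` monotone, and `φ ≤ c/2` makes `L φ = N (cos (x - κ))`
with `N` monotone too. If `N 1 - N (cos y)` is at least a multiple of `y²`, then `c/2 - φ` is at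
least a multiple of `|y|` near the crest: a corner, where a maximum cannot be differentiable.

The quadratic lower bound is a strong form of positivity for `L`. Both assumptions make `m k`, for
`k ≠ 0`, the moment `∫ s^(k² - 1) dμ(s)` of a positive measure on `[0, 1]`, so away from constants
`L` is an average of heat operators with multipliers `s^(k²)`. By the Jacobi triple product the heat
kernel is an increasing function of `cos x`, with an explicit rate (`le_heatKernel_sub`).
Symmetrizing the convolution then gives a drop of each heat flow of `φ` of at least a multiple of `1
- cos x` (`le_heat_diff`); the multiple contains the first cosine coefficient of `M`, which is
positive since `φ` is nontrivial.

The rate degenerates as `s → 1`, but decay of the moments keeps `μ` from concentrating there. The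
measure is never constructed: `IsCompletelyMonotone.le_tsum_mul` transfers inequalities in `s` to
the moment sequence. An additional heat factor `q` makes all series converge, and `q → 1` at the end
of `exists_mul_one_sub_cos_le`. -/

namespace SteadyWave

open Filter Topology

/-! ### Completely monotone sequences as moment sequences -/

/-- The alternating differences `(-1)ᵖ Δᵖ a(i)`. -/
noncomputable def altDiff (a : ℕ → ℝ) (p i : ℕ) : ℝ := (-1 : ℝ) ^ p * (fwdDiff (1 : ℕ))^[p] a i

theorem altDiff_zero (a : ℕ → ℝ) (i : ℕ) : altDiff a 0 i = a i := by simp [altDiff]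

theorem altDiff_succ (a : ℕ → ℝ) (p i : ℕ) :
    altDiff a (p + 1) i = altDiff a p i - altDiff a p (i + 1) := by
  simp only [altDiff, Function.iterate_succ_apply', fwdDiff, pow_succ]
  ring

theorem altDiff_shift (a : ℕ → ℝ) (p i : ℕ) :
    altDiff (fun j => a (j + 1)) p i = altDiff a p (i + 1) := by
  simp only [altDiff, fwdDiff_iter_comp_add]

theorem IsCompletelyMonotone.altDiff_nonneg {a : ℕ → ℝ} (ha : IsCompletelyMonotone a) (p i : ℕ) :
    0 ≤ altDiff a p i := ha p i

theorem IsCompletelyMonotone.shift {a : ℕ → ℝ} (ha : IsCompletelyMonotone a) :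
    IsCompletelyMonotone (fun j => a (j + 1)) := fun p i => by
  have := ha p (i + 1)
  rwa [fwdDiff_iter_comp_add]

theorem IsCompletelyMonotone.nonneg {a : ℕ → ℝ} (ha : IsCompletelyMonotone a) (i : ℕ) :
    0 ≤ a i := by
  simpa [altDiff_zero] using ha.altDiff_nonneg 0 i

/-- The atomic functional approximating the representing measure of a moment sequence. -/
noncomputable def momentFunctional (a : ℕ → ℝ) (N : ℕ) (h : ℝ → ℝ) : ℝ :=
  ∑ i ∈ Finset.range (N + 1), h (i / N) * (N.choose i * altDiff a (N - i) i)

/-- If `a j = ∫ s^j dμ`, then `altDiff a p i = ∫ s^i (1 - s)^p dμ`, and the sum integrates `(s + (1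
- s))^N = 1`. The algebraic proof needs free offsets `p`, `j` so that Pascal's rule closes the
induction. -/
theorem sum_choose_mul_altDiff (a : ℕ → ℝ) (N : ℕ) :
    ∑ i ∈ Finset.range (N + 1), (N.choose i * altDiff a (N - i) i) = a 0 := by
  suffices h : ∀ N p j, ∑ i ∈ Finset.range (N + 1), (N.choose i * altDiff a (p + (N - i)) (j + i))
      = altDiff a p j by
    simpa [altDiff_zero] using h N 0 0
  intro N
  induction N with
  | zero => intro p j; simp
  | succ N ih =>
    intro p j
    have e : altDiff a p j = altDiff a (p + 1) j + altDiff a p (j + 1) := by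
      rw [altDiff_succ]; ring
    rw [e, ← ih (p + 1) j, ← ih p (j + 1), Finset.sum_range_succ' _ (N + 1)]
    have h1 : ∀ i, ((N + 1).choose (i + 1) : ℝ) * altDiff a (p + (N + 1 - (i + 1))) (j + (i + 1)) =
        N.choose i * altDiff a (p + (N - i)) (j + 1 + i) +
          N.choose (i + 1) * altDiff a (p + (N - i)) (j + (i + 1)) := by
      intro i
      rw [Nat.choose_succ_succ, show N + 1 - (i + 1) = N - i by omega,
        show j + 1 + i = j + (i + 1) by omega]
      push_cast
      ring
    simp_rw [h1, Finset.sum_add_distrib]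
    rw [Finset.sum_range_succ (fun i => (N.choose (i + 1) : ℝ) * altDiff a (p + (N - i)) (j + (i + 1))),
      Finset.sum_range_succ' (fun i => (N.choose i : ℝ) * altDiff a (p + 1 + (N - i)) (j + i))]
    have h2 : ∑ i ∈ Finset.range N, (N.choose (i + 1) : ℝ) * altDiff a (p + (N - i)) (j + (i + 1)) =
        ∑ i ∈ Finset.range N,
          (N.choose (i + 1) : ℝ) * altDiff a (p + 1 + (N - (i + 1))) (j + (i + 1)) := by
      refine Finset.sum_congr rfl fun i hi => ?_
      rw [Finset.mem_range] at hi
      rw [show p + 1 + (N - (i + 1)) = p + (N - i) by omega]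
    rw [h2, show p + (N + 1 - 0) = p + 1 + (N - 0) by omega]
    simp
    ring

theorem abs_pow_sub_pow_le_mul {x y : ℝ} (hx : x ∈ Icc (0 : ℝ) 1) (hy : y ∈ Icc (0 : ℝ) 1)
    (j : ℕ) : |x ^ j - y ^ j| ≤ j * |x - y| := by
  induction j with
  | zero => simp
  | succ j ih =>
    have e : x ^ (j + 1) - y ^ (j + 1) = x * (x ^ j - y ^ j) + (x - y) * y ^ j := by ring
    have h1 : |x * (x ^ j - y ^ j)| ≤ |x ^ j - y ^ j| := by
      rw [abs_mul, abs_of_nonneg hx.1]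
      exact mul_le_of_le_one_left (abs_nonneg _) hx.2
    have h2 : |(x - y) * y ^ j| ≤ |x - y| := by
      rw [abs_mul, abs_of_nonneg (pow_nonneg hy.1 j)]
      exact mul_le_of_le_one_right (abs_nonneg _) (pow_le_one₀ hy.1 hy.2)
    calc |x ^ (j + 1) - y ^ (j + 1)| ≤ |x * (x ^ j - y ^ j)| + |(x - y) * y ^ j| := by
          rw [e]; exact abs_add_le _ _
      _ ≤ j * |x - y| + |x - y| := add_le_add (h1.trans ih) h2
      _ = ((j + 1 : ℕ) : ℝ) * |x - y| := by push_cast; ring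

theorem natCast_div_mem_Icc {i N : ℕ} (h : i ≤ N) : (i / N : ℝ) ∈ Icc (0 : ℝ) 1 :=
  ⟨by positivity, div_le_one_of_le₀ (by exact_mod_cast h) (by positivity)⟩

/-- The identity `(N + 1) * choose N i = (i + 1) * choose (N + 1) (i + 1)` absorbs one factor of the
power into the weight. What remains are the level `N` weights of the shifted sequence, sampled at
`(i + 1) / (N + 1)` instead of `i / N`. -/
theorem momentFunctional_pow_succ (a : ℕ → ℝ) (N j : ℕ) :
    momentFunctional a (N + 1) (· ^ (j + 1)) =
      ∑ i ∈ Finset.range (N + 1), (((i + 1 : ℕ) : ℝ) / (N + 1 : ℕ)) ^ j *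
        (N.choose i * altDiff (fun j => a (j + 1)) (N - i) i) := by
  rw [momentFunctional, Finset.sum_range_succ']
  simp only [Nat.cast_zero, zero_div, ne_eq, Nat.add_eq_zero_iff, one_ne_zero, and_false,
    not_false_eq_true, zero_pow, zero_mul, add_zero]
  refine Finset.sum_congr rfl fun i _ => ?_
  have h : ((N + 1 : ℕ) : ℝ) * N.choose i = (N + 1).choose (i + 1) * (i + 1 : ℕ) := by
    exact_mod_cast Nat.add_one_mul_choose_eq N i
  have h0 : ((N + 1 : ℕ) : ℝ) ≠ 0 := by positivity
  have h' : (N.choose i : ℝ) = (N + 1).choose (i + 1) * (i + 1 : ℕ) / (N + 1 : ℕ) := by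
    rw [← h]; field_simp
  rw [altDiff_shift, show N + 1 - (i + 1) = N - i by omega, h', pow_succ]
  ring

/-- Induction on `j` through the shifted sequence: moving the sample points costs at most `1 / (N +
1)` each, `s ^ j` is `j`-Lipschitz on `[0, 1]`, and the weights have total mass `a 1`. -/
theorem IsCompletelyMonotone.tendsto_momentFunctional_pow {a : ℕ → ℝ}
    (ha : IsCompletelyMonotone a) (j : ℕ) :
    Tendsto (fun N => momentFunctional a N (· ^ j)) atTop (𝓝 (a j)) := by
  induction j generalizing a with
  | zero => simp [momentFunctional, sum_choose_mul_altDiff]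
  | succ j ih =>
    rw [← tendsto_add_atTop_iff_nat 1]
    have hb := ih ha.shift
    have hlim : Tendsto (fun N : ℕ => (j : ℝ) * (1 / ((N : ℝ) + 1)) * a 1) atTop (𝓝 0) := by
      simpa using (tendsto_one_div_add_atTop_nhds_zero_nat.const_mul (j : ℝ)).mul_const (a 1)
    refine tendsto_of_tendsto_of_dist hb (squeeze_zero' (.of_forall fun _ => dist_nonneg) ?_ hlim)
    filter_upwards [eventually_gt_atTop 0] with N hN
    have hN' : (0 : ℝ) < N := by exact_mod_cast hN
    rw [momentFunctional_pow_succ, momentFunctional, Real.dist_eq, ← Finset.sum_sub_distrib]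
    refine (Finset.abs_sum_le_sum_abs _ _).trans ?_
    have hs := sum_choose_mul_altDiff (fun j => a (j + 1)) N
    simp only [zero_add] at hs
    rw [← hs, Finset.mul_sum]
    refine Finset.sum_le_sum fun i hi => ?_
    have hi : i ≤ N := Nat.lt_succ_iff.1 (Finset.mem_range.1 hi)
    have hi' : (i : ℝ) ≤ N := by exact_mod_cast hi
    have hw : (0 : ℝ) ≤ N.choose i * altDiff (fun j => a (j + 1)) (N - i) i :=
      mul_nonneg (by positivity) (ha.shift.altDiff_nonneg _ _)
    rw [← sub_mul, abs_mul, abs_of_nonneg hw]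
    refine mul_le_mul_of_nonneg_right ?_ hw
    refine (abs_pow_sub_pow_le_mul (natCast_div_mem_Icc hi)
      (natCast_div_mem_Icc (Nat.succ_le_succ hi)) j).trans ?_
    refine mul_le_mul_of_nonneg_left ?_ (by positivity)
    have e : (i / N : ℝ) - ((i + 1 : ℕ) : ℝ) / (N + 1 : ℕ) = -((N - i) / N * (1 / (N + 1))) := by
      push_cast; field_simp; ring
    rw [e, abs_neg, abs_of_nonneg (mul_nonneg (div_nonneg (by linarith) hN'.le) (by positivity))]
    refine mul_le_of_le_one_left (by positivity) (div_le_one_of_le₀ ?_ hN'.le)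
    have : (0 : ℝ) ≤ i := by positivity
    linarith

theorem momentFunctional_mono {a : ℕ → ℝ} (ha : IsCompletelyMonotone a) (N : ℕ) {f g : ℝ → ℝ}
    (h : ∀ s ∈ Icc (0 : ℝ) 1, f s ≤ g s) : momentFunctional a N f ≤ momentFunctional a N g := by
  refine Finset.sum_le_sum fun i hi => mul_le_mul_of_nonneg_right ?_
    (mul_nonneg (by positivity) (ha.altDiff_nonneg _ _))
  exact h _ (natCast_div_mem_Icc (Nat.lt_succ_iff.1 (Finset.mem_range.1 hi)))

/-- Moment sequences preserve lower bounds of absolutely convergent power series by binomials. -/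
theorem IsCompletelyMonotone.le_tsum_mul {ι : Type*} {a : ℕ → ℝ} (ha : IsCompletelyMonotone a)
    {u : ι → ℝ} {e : ι → ℕ} (hu : Summable fun i => |u i|) {α β : ℝ} {J : ℕ}
    (h : ∀ s ∈ Icc (0 : ℝ) 1, α - β * s ^ J ≤ ∑' i, u i * s ^ e i) :
    α * a 0 - β * a J ≤ ∑' i, u i * a (e i) := by
  -- The functionals are positive, so the hypothesis holds for each of them; both sides then
  -- converge as `N → ∞`, the right one by dominated convergence.
  have hL : Tendsto (fun N => momentFunctional a N (fun s => α - β * s ^ J)) atTop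
      (𝓝 (α * a 0 - β * a J)) := by
    have := ((ha.tendsto_momentFunctional_pow 0).const_mul α).sub
      ((ha.tendsto_momentFunctional_pow J).const_mul β)
    refine this.congr fun N => ?_
    simp only [momentFunctional, Finset.mul_sum, ← Finset.sum_sub_distrib]
    exact Finset.sum_congr rfl fun i _ => by ring
  have hN : ∀ N j, |momentFunctional a N (· ^ j)| ≤ a 0 := by
    intro N j
    have h0 : momentFunctional a N (fun _ => 0) = 0 := by simp [momentFunctional]
    have h1 : momentFunctional a N (fun _ => 1) = a 0 := by
      simp [momentFunctional, sum_choose_mul_altDiff]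
    rw [abs_of_nonneg, ← h1]
    · exact momentFunctional_mono ha N fun s hs => pow_le_one₀ hs.1 hs.2
    · rw [← h0]
      exact momentFunctional_mono ha N fun s hs => pow_nonneg hs.1 _
  have hR : Tendsto (fun N => ∑' i, u i * momentFunctional a N (· ^ e i)) atTop
      (𝓝 (∑' i, u i * a (e i))) := by
    refine tendsto_tsum_of_dominated_convergence (bound := fun i => |u i| * a 0)
      (hu.mul_right _) (fun i => (ha.tendsto_momentFunctional_pow (e i)).const_mul (u i)) ?_
    refine .of_forall fun N i => ?_
    rw [Real.norm_eq_abs, abs_mul]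
    exact mul_le_mul_of_nonneg_left (hN N _) (abs_nonneg _)
  refine le_of_tendsto_of_tendsto' hL hR fun N => (momentFunctional_mono ha N h).trans_eq ?_
  have hs : ∀ i ∈ Finset.range (N + 1), Summable fun k =>
      u k * (i / N : ℝ) ^ e k * (N.choose i * altDiff a (N - i) i) := by
    intro i hi
    refine Summable.mul_right _ (Summable.of_norm_bounded hu fun k => ?_)
    have := natCast_div_mem_Icc (Nat.lt_succ_iff.1 (Finset.mem_range.1 hi))
    rw [Real.norm_eq_abs, abs_mul, abs_of_nonneg (pow_nonneg this.1 _)]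
    exact mul_le_of_le_one_right (abs_nonneg _) (pow_le_one₀ this.1 this.2)
  simp only [momentFunctional, Finset.mul_sum, ← tsum_mul_right]
  rw [← Summable.tsum_finsetSum hs]
  exact tsum_congr fun k => Finset.sum_congr rfl fun i _ => by ring

/-- `(j + 1)^(-p)` is a completely monotone sequence for `p > 0`. -/
theorem isCompletelyMonotone_rpow {p : ℝ} (hp : 0 < p) :
    IsCompletelyMonotone fun j : ℕ => ((j + 1 : ℕ) : ℝ) ^ (-p) := by
  have hint : ∀ n k : ℕ, IntegrableOn
      (fun t : ℝ => t ^ (p - 1) * Real.exp (-((k + 1 : ℕ) * t)) * (1 - Real.exp (-t)) ^ n)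
      (Ioi 0) := by
    intro n k
    refine Integrable.mono' (Real.GammaIntegral_convergent hp) ?_ ?_
    · refine (ContinuousOn.mul (ContinuousOn.mul ?_ (by fun_prop)) (by fun_prop)).aestronglyMeasurable
        measurableSet_Ioi
      exact continuousOn_id.rpow_const fun x hx => Or.inl (ne_of_gt hx)
    · refine (ae_restrict_iff' measurableSet_Ioi).2 (.of_forall fun t (ht : 0 < t) => ?_)
      have h2 : Real.exp (-t) ≤ 1 := Real.exp_le_one_iff.2 (by linarith)
      have h3 : |(1 - Real.exp (-t)) ^ n| ≤ 1 := by
        rw [abs_pow]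
        refine pow_le_one₀ (abs_nonneg _) (abs_le.2 ⟨by linarith, ?_⟩)
        linarith [Real.exp_pos (-t)]
      rw [norm_mul, Real.norm_eq_abs ((1 - Real.exp (-t)) ^ n), Real.norm_of_nonneg (by positivity)]
      refine (mul_le_of_le_one_right (by positivity) h3).trans ?_
      rw [mul_comm]
      refine mul_le_mul_of_nonneg_right (Real.exp_le_exp.2 ?_) (by positivity)
      have : 0 ≤ (k : ℝ) * t := by positivity
      push_cast
      linarith
  -- Gamma integral for `(k + 1)^(-p)`: each alternating difference multiplies the integrand by `1 -
  -- e^(-t) ≥ 0`.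
  have key : ∀ n k : ℕ, altDiff (fun j : ℕ => ((j + 1 : ℕ) : ℝ) ^ (-p)) n k =
      (Real.Gamma p)⁻¹ * ∫ t in Ioi (0 : ℝ),
        t ^ (p - 1) * Real.exp (-((k + 1 : ℕ) * t)) * (1 - Real.exp (-t)) ^ n := by
    intro n
    induction n with
    | zero =>
      intro k
      have := Real.integral_rpow_mul_exp_neg_mul_Ioi hp (r := ((k + 1 : ℕ) : ℝ)) (by positivity)
      simp only [pow_zero, mul_one, altDiff_zero]
      rw [this, one_div, Real.inv_rpow (by positivity), ← Real.rpow_neg (by positivity)]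
      field_simp [(Real.Gamma_pos_of_pos hp).ne']
    | succ n ih =>
      intro k
      rw [altDiff_succ, ih, ih, ← mul_sub, ← integral_sub (hint n k) (hint n (k + 1))]
      congr 1
      refine integral_congr_ae (.of_forall fun t => ?_)
      have : Real.exp (-((k + 1 + 1 : ℕ) * t)) =
          Real.exp (-((k + 1 : ℕ) * t)) * Real.exp (-t) := by
        rw [← Real.exp_add]; congr 1; push_cast; ring
      simp only [this]
      ring
  intro n k
  change 0 ≤ altDiff _ n k
  rw [key]
  refine mul_nonneg (inv_nonneg.2 (Real.Gamma_pos_of_pos hp).le)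
    (setIntegral_nonneg measurableSet_Ioi fun t (ht : 0 < t) => ?_)
  have h2 : Real.exp (-t) ≤ 1 := Real.exp_le_one_iff.2 (by linarith)
  have h3 : 0 ≤ 1 - Real.exp (-t) := by linarith
  positivity

theorem IsCompletelyMonotone.const_mul {a : ℕ → ℝ} (ha : IsCompletelyMonotone a) {b : ℝ}
    (hb : 0 ≤ b) : IsCompletelyMonotone fun j => b * a j := fun n k => by
  have : (fun j => b * a j) = b • a := rfl
  rw [this, fwdDiff_iter_const_smul, Pi.smul_apply, smul_eq_mul, mul_left_comm]
  exact mul_nonneg hb (ha n k)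

/-! ### Euler products -/

/-- The finite Euler product `∏_{i=1}^{n} (1 - Qⁱ)`. -/
noncomputable def eulerProd (Q : ℝ) (n : ℕ) : ℝ := ∏ i ∈ Finset.range n, (1 - Q ^ (i + 1))

/-- A positive lower bound for all finite Euler products. -/
noncomputable def eulerBound (Q : ℝ) : ℝ := Real.exp (-((1 - Q) ^ 2)⁻¹)

theorem eulerBound_pos (Q : ℝ) : 0 < eulerBound Q := Real.exp_pos _

theorem eulerBound_anti {P Q : ℝ} (h : P ≤ Q) (hQ : Q < 1) : eulerBound Q ≤ eulerBound P := by
  have h1 : (0 : ℝ) < (1 - Q) ^ 2 := pow_pos (by linarith) 2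
  have h2 : (1 - Q) ^ 2 ≤ (1 - P) ^ 2 := pow_le_pow_left₀ (by linarith) (by linarith) 2
  exact Real.exp_le_exp.2 (neg_le_neg (inv_anti₀ h1 h2))

/-- From `log y ≥ 1 - 1/y`, each factor is at least `exp (-Q^i / (1 - Q))`, and these exponents form
a geometric series. -/
theorem eulerBound_le_eulerProd {Q : ℝ} (h0 : 0 ≤ Q) (h1 : Q < 1) (n : ℕ) :
    eulerBound Q ≤ eulerProd Q n := by
  have hf : ∀ i : ℕ, Real.exp (-(Q ^ i * (1 - Q)⁻¹)) ≤ 1 - Q ^ (i + 1) := by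
    intro i
    have hQ : Q ^ (i + 1) ≤ Q := pow_le_of_le_one h0 h1.le (by omega)
    have hpos : 0 < 1 - Q ^ (i + 1) := by linarith
    rw [← Real.le_log_iff_exp_le hpos]
    refine le_trans ?_ (Real.one_sub_inv_le_log_of_pos hpos)
    have e : 1 - (1 - Q ^ (i + 1))⁻¹ = -(Q ^ (i + 1) * (1 - Q ^ (i + 1))⁻¹) := by
      field_simp; ring
    rw [e, neg_le_neg_iff]
    have h3 : Q ^ (i + 1) ≤ Q ^ i := pow_le_pow_of_le_one h0 h1.le (by omega)
    exact mul_le_mul h3 (inv_anti₀ (by linarith) (by linarith)) (inv_nonneg.2 hpos.le)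
      (pow_nonneg h0 _)
  have hs : ∑ i ∈ Finset.range n, Q ^ i * (1 - Q)⁻¹ ≤ ((1 - Q) ^ 2)⁻¹ := by
    rw [← Finset.sum_mul, pow_two, mul_inv]
    refine mul_le_mul_of_nonneg_right ?_ (inv_nonneg.2 (by linarith))
    rw [← tsum_geometric_of_lt_one h0 h1]
    exact (summable_geometric_of_lt_one h0 h1).sum_le_tsum _ fun i _ => pow_nonneg h0 i
  calc eulerBound Q ≤ Real.exp (∑ i ∈ Finset.range n, -(Q ^ i * (1 - Q)⁻¹)) := by
        rw [Finset.sum_neg_distrib]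
        exact Real.exp_le_exp.2 (neg_le_neg hs)
    _ = ∏ i ∈ Finset.range n, Real.exp (-(Q ^ i * (1 - Q)⁻¹)) := Real.exp_sum _ _
    _ ≤ eulerProd Q n := Finset.prod_le_prod (fun i _ => (Real.exp_pos _).le) fun i _ => hf i

theorem eulerProd_pos {Q : ℝ} (h0 : 0 ≤ Q) (h1 : Q < 1) (n : ℕ) : 0 < eulerProd Q n :=
  (eulerBound_pos Q).trans_le (eulerBound_le_eulerProd h0 h1 n)

theorem eulerProd_antitone {Q : ℝ} (h0 : 0 ≤ Q) (h1 : Q < 1) : Antitone (eulerProd Q) :=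
  antitone_nat_of_succ_le fun n => by
    rw [eulerProd, Finset.prod_range_succ]
    have : 0 ≤ Q ^ (n + 1) := pow_nonneg h0 _
    exact mul_le_of_le_one_right (eulerProd_pos h0 h1 n).le (by linarith)

theorem eulerProd_le_one {Q : ℝ} (h0 : 0 ≤ Q) (h1 : Q < 1) (n : ℕ) : eulerProd Q n ≤ 1 :=
  (eulerProd_antitone h0 h1 n.zero_le).trans_eq (by simp [eulerProd])

/-- The reciprocal of the Euler product, extended by zero to negative indices. -/
noncomputable def eulerInv (Q : ℝ) (n : ℤ) : ℝ := if 0 ≤ n then (eulerProd Q n.toNat)⁻¹ else 0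

/-- Extension by zero makes the recursion valid for all integers: at `n = 0` the factor `1 - Q^0`
vanishes. -/
theorem eulerInv_sub_one {Q : ℝ} (h0 : 0 ≤ Q) (h1 : Q < 1) (n : ℤ) :
    eulerInv Q (n - 1) = eulerInv Q n * (1 - Q ^ n) := by
  rcases lt_trichotomy n 0 with h | rfl | h
  · simp [eulerInv, not_le.2 h, show ¬ 1 ≤ n by omega]
  · simp [eulerInv]
  · obtain ⟨j, rfl⟩ : ∃ j : ℕ, n = (j + 1 : ℕ) := ⟨(n - 1).toNat, by omega⟩
    have e : ((j + 1 : ℕ) : ℤ) - 1 = (j : ℕ) := by push_cast; ring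
    have hj := eulerProd_pos h0 h1 (j + 1)
    rw [e, eulerInv, if_pos (by omega), eulerInv, if_pos (by omega), Int.toNat_natCast,
      Int.toNat_natCast, zpow_natCast]
    have hj' : eulerProd Q (j + 1) = eulerProd Q j * (1 - Q ^ (j + 1)) := Finset.prod_range_succ _ _
    rw [hj'] at hj ⊢
    have := (eulerProd_pos h0 h1 j).ne'
    have h3 : 1 - Q ^ (j + 1) ≠ 0 := fun h => by simp [h] at hj
    field_simp

theorem eulerInv_nonneg {Q : ℝ} (h0 : 0 ≤ Q) (h1 : Q < 1) (n : ℤ) : 0 ≤ eulerInv Q n := by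
  rw [eulerInv]
  split_ifs
  exacts [inv_nonneg.2 (eulerProd_pos h0 h1 _).le, le_rfl]

theorem eulerInv_le {Q : ℝ} (h0 : 0 ≤ Q) (h1 : Q < 1) (n : ℤ) :
    eulerInv Q n ≤ (eulerBound Q)⁻¹ := by
  rw [eulerInv]
  split_ifs
  exacts [inv_anti₀ (eulerBound_pos Q) (eulerBound_le_eulerProd h0 h1 _),
    inv_nonneg.2 (eulerBound_pos Q).le]

theorem exists_tendsto_eulerInv {Q : ℝ} (h0 : 0 ≤ Q) (h1 : Q < 1) :
    ∃ E : ℝ, 0 < E ∧ E ≤ (eulerBound Q)⁻¹ ∧ Tendsto (eulerInv Q) atTop (𝓝 E) := by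
  have hb : BddBelow (range (eulerProd Q)) :=
    ⟨eulerBound Q, by rintro _ ⟨n, rfl⟩; exact eulerBound_le_eulerProd h0 h1 n⟩
  have ht := tendsto_atTop_ciInf (eulerProd_antitone h0 h1) hb
  set L := ⨅ n, eulerProd Q n
  have hL : eulerBound Q ≤ L := le_ciInf fun n => eulerBound_le_eulerProd h0 h1 n
  have hL0 := (eulerBound_pos Q).trans_le hL
  refine ⟨L⁻¹, inv_pos.2 hL0, inv_anti₀ (eulerBound_pos Q) hL, ?_⟩
  have h2 : Tendsto (fun n : ℤ => n.toNat) atTop atTop :=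
    tendsto_atTop_atTop.2 fun b => ⟨b, fun a ha => by omega⟩
  refine ((ht.comp h2).inv₀ hL0.ne').congr' ?_
  filter_upwards [eventually_ge_atTop 0] with n hn
  simp [eulerInv, hn]

/-! ### The finite Jacobi triple product -/

/-- The finite triple product in the variable `c = cos x`. -/
noncomputable def tripleProd (σ : ℝ) (N : ℕ) (c : ℝ) : ℝ :=
  ∏ i ∈ Finset.range N, (1 + 2 * σ ^ (2 * i + 1) * c + (σ ^ (2 * i + 1)) ^ 2)

/-- The Fourier coefficients of the normalized finite triple product. -/
noncomputable def tripleCoeff (σ : ℝ) (N : ℕ) (k : ℤ) : ℝ :=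
  σ ^ (k.natAbs ^ 2) * (eulerInv (σ ^ 2) (N - k) * eulerInv (σ ^ 2) (N + k))

/-- This is the effect on coefficients of multiplying by `1 + 2ρ cos x + ρ²`, `ρ = σ^(2N+1)`. Once
every reciprocal Euler product is expressed through those at `N + 1 ± k`, it is a rational identity
in `σ ^ k` and `σ ^ N`. -/
theorem tripleCoeff_succ {σ : ℝ} (h0 : 0 < σ) (h1 : σ < 1) (N : ℕ) (k : ℤ) :
    tripleCoeff σ (N + 1) k * ((1 - (σ ^ 2) ^ (2 * N + 1)) * (1 - (σ ^ 2) ^ (2 * N + 2))) =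
      (1 + (σ ^ (2 * N + 1)) ^ 2) * tripleCoeff σ N k +
        σ ^ (2 * N + 1) * (tripleCoeff σ N (k - 1) + tripleCoeff σ N (k + 1)) := by
  have hQ0 : 0 ≤ σ ^ 2 := by positivity
  have hQ1 : σ ^ 2 < 1 := pow_lt_one₀ h0.le h1 two_ne_zero
  have hσ := h0.ne'
  have hp : ∀ j : ℤ, σ ^ (j.natAbs ^ 2) = σ ^ (j ^ 2 : ℤ) := by
    intro j
    rw [← Int.natAbs_sq, ← zpow_natCast]
    push_cast
    rfl
  have e1 := eulerInv_sub_one hQ0 hQ1 (N + 1 - k)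
  have e2 := eulerInv_sub_one hQ0 hQ1 (N + 1 + k)
  have e3 := eulerInv_sub_one hQ0 hQ1 (N - k)
  have e4 := eulerInv_sub_one hQ0 hQ1 (N + k)
  rw [show (N + 1 - k - 1 : ℤ) = N - k by ring] at e1
  rw [show (N + 1 + k - 1 : ℤ) = N + k by ring] at e2
  rw [e1] at e3
  rw [e2] at e4
  simp only [tripleCoeff, hp]
  push_cast
  rw [show (N - (k - 1) : ℤ) = N + 1 - k by ring, show (N + (k - 1) : ℤ) = N + k - 1 by ring,
    show (N - (k + 1) : ℤ) = N - k - 1 by ring, show (N + (k + 1) : ℤ) = N + 1 + k by ring,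
    e3, e4, e1, e2]
  generalize eulerInv (σ ^ 2) (N + 1 - k) = E
  generalize eulerInv (σ ^ 2) (N + 1 + k) = F
  have z1 : σ ^ ((k - 1) ^ 2 : ℤ) = σ ^ (k ^ 2 : ℤ) * σ / (σ ^ k) ^ 2 := by
    rw [eq_div_iff (by positivity), ← zpow_natCast, ← zpow_mul, ← zpow_add₀ hσ, ← zpow_add_one₀ hσ]
    congr 1; push_cast; ring
  have z2 : σ ^ ((k + 1) ^ 2 : ℤ) = σ ^ (k ^ 2 : ℤ) * σ * (σ ^ k) ^ 2 := by
    rw [← zpow_natCast (σ ^ k), ← zpow_mul, ← zpow_add_one₀ hσ, ← zpow_add₀ hσ]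
    congr 1; push_cast; ring
  have hc : ∀ j : ℤ, (σ ^ 2) ^ j = (σ ^ j) ^ 2 := by
    intro j
    rw [← zpow_natCast σ 2, ← zpow_natCast (σ ^ j) 2, ← zpow_mul, ← zpow_mul, mul_comm]
  simp only [hc, z1, z2, zpow_add₀ hσ, zpow_sub₀ hσ, zpow_natCast, zpow_one]
  have ht : σ ^ k ≠ 0 := zpow_ne_zero _ hσ
  generalize σ ^ k = t at *
  generalize σ ^ (k ^ 2) = a
  simp only [pow_add, pow_mul', pow_one]
  field_simp
  ring

theorem tripleCoeff_eq_zero {σ : ℝ} {N : ℕ} {k : ℤ} (hk : k ∉ Finset.Icc (-N : ℤ) N) :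
    tripleCoeff σ N k = 0 := by
  rw [Finset.mem_Icc, not_and_or, not_le, not_le] at hk
  rcases hk with hk | hk
  · simp [tripleCoeff, eulerInv, show ¬ (0 : ℤ) ≤ N + k by omega]
  · rw [tripleCoeff, eulerInv, if_neg (by omega), zero_mul, mul_zero]

theorem hasSum_tripleCoeff {σ : ℝ} (h0 : 0 < σ) (h1 : σ < 1) (x : ℝ) (N : ℕ) :
    HasSum (fun k : ℤ => tripleCoeff σ N k * Real.cos (k * x))
      (tripleProd σ N (Real.cos x) / eulerProd (σ ^ 2) (2 * N)) := by
  have hQ0 : 0 ≤ σ ^ 2 := by positivity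
  have hQ1 : σ ^ 2 < 1 := pow_lt_one₀ h0.le h1 two_ne_zero
  induction N with
  | zero =>
    have : tripleProd σ 0 (Real.cos x) / eulerProd (σ ^ 2) (2 * 0) =
        tripleCoeff σ 0 0 * Real.cos ((0 : ℤ) * x) := by
      simp [tripleProd, eulerProd, tripleCoeff, eulerInv]
    rw [this]
    refine hasSum_single 0 fun k hk => ?_
    rw [tripleCoeff_eq_zero (by simpa using hk), zero_mul]
  | succ N ih =>
    have hs : ∀ f : ℤ → ℝ, Summable fun k => tripleCoeff σ N k * f k := fun f =>
      summable_of_ne_finset_zero (s := Finset.Icc (-N : ℤ) N) fun k hk => by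
        rw [tripleCoeff_eq_zero hk, zero_mul]
    have hA := (hs fun k => Real.cos ((k + 1 : ℤ) * x)).hasSum
    have hB := (hs fun k => Real.cos ((k - 1 : ℤ) * x)).hasSum
    -- The product formula `2 cos x cos kx = cos (k+1)x + cos (k-1)x`; reindexing then produces the
    -- neighbouring coefficients.
    have hAB := (hA.add hB).unique ((ih.mul_left (2 * Real.cos x)).congr_fun fun k => by
      have e1 : ((k + 1 : ℤ) : ℝ) * x = k * x + x := by push_cast; ring
      have e2 : ((k - 1 : ℤ) : ℝ) * x = k * x - x := by push_cast; ring
      simp only [e1, e2, Real.cos_add, Real.cos_sub]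
      ring)
    have hA' := (Equiv.subRight (1 : ℤ)).hasSum_iff.2 hA
    have hB' := (Equiv.addRight (1 : ℤ)).hasSum_iff.2 hB
    have hd1 : 1 - (σ ^ 2) ^ (2 * N + 1) ≠ 0 :=
      (sub_pos.2 (pow_lt_one₀ hQ0 hQ1 (by omega))).ne'
    have hd2 : 1 - (σ ^ 2) ^ (2 * N + 2) ≠ 0 :=
      (sub_pos.2 (pow_lt_one₀ hQ0 hQ1 (by omega))).ne'
    have key := ((ih.mul_left (1 + (σ ^ (2 * N + 1)) ^ 2)).add
      ((hA'.add hB').mul_left (σ ^ (2 * N + 1)))).div_const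
        ((1 - (σ ^ 2) ^ (2 * N + 1)) * (1 - (σ ^ 2) ^ (2 * N + 2)))
    rw [hAB] at key
    have he : eulerProd (σ ^ 2) (2 * (N + 1)) = eulerProd (σ ^ 2) (2 * N) *
        (1 - (σ ^ 2) ^ (2 * N + 1)) * (1 - (σ ^ 2) ^ (2 * N + 2)) := by
      rw [show 2 * (N + 1) = 2 * N + 1 + 1 by ring, eulerProd, Finset.prod_range_succ,
        Finset.prod_range_succ]
      rfl
    have ht : tripleProd σ (N + 1) (Real.cos x) = tripleProd σ N (Real.cos x) *
        (1 + 2 * σ ^ (2 * N + 1) * Real.cos x + (σ ^ (2 * N + 1)) ^ 2) :=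
      Finset.prod_range_succ _ _
    rw [he, ht]
    have hv : ∀ p e d ρ γ : ℝ, p * (1 + 2 * ρ * γ + ρ ^ 2) / (e * d) =
        ((1 + ρ ^ 2) * (p / e) + ρ * (2 * γ * (p / e))) / d := by
      intro p e d ρ γ
      rw [← div_div]
      ring
    rw [mul_assoc (eulerProd (σ ^ 2) (2 * N)), hv]
    refine key.congr_fun fun k => ?_
    rw [eq_div_iff (mul_ne_zero hd1 hd2), mul_right_comm, tripleCoeff_succ h0 h1]
    simp
    ring

/-! ### The heat kernel as an increasing function of `cos x` -/

/-- The periodic heat kernel `∑ₖ σ^(k²) cos(kx)`. -/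
noncomputable def heatKernel (σ x : ℝ) : ℝ := ∑' k : ℤ, σ ^ (k.natAbs ^ 2) * Real.cos (k * x)

theorem summable_pow_natAbs_sq {σ : ℝ} (h0 : 0 ≤ σ) (h1 : σ < 1) :
    Summable fun k : ℤ => σ ^ (k.natAbs ^ 2) := by
  have h : Summable fun n : ℕ => σ ^ (n ^ 2) :=
    (summable_geometric_of_lt_one h0 h1).of_nonneg_of_le (fun n => pow_nonneg h0 _) fun n =>
      pow_le_pow_of_le_one h0 h1.le (Nat.le_self_pow two_ne_zero n)
  exact Summable.of_nat_of_neg (by simpa using h) (by simpa using h)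

/-- The Jacobi triple product: each coefficient tends to `σ^(k²) E²`, dominated by a summable
multiple of `σ^(k²)`. -/
theorem tendsto_tripleProd {σ E : ℝ} (h0 : 0 < σ) (h1 : σ < 1)
    (hE : Tendsto (eulerInv (σ ^ 2)) atTop (𝓝 E)) (x : ℝ) :
    Tendsto (fun N : ℕ => tripleProd σ N (Real.cos x) / eulerProd (σ ^ 2) (2 * N)) atTop
      (𝓝 (E ^ 2 * heatKernel σ x)) := by
  have hQ0 : 0 ≤ σ ^ 2 := by positivity
  have hQ1 : σ ^ 2 < 1 := pow_lt_one₀ h0.le h1 two_ne_zero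
  have he : E ^ 2 * heatKernel σ x =
      ∑' k : ℤ, σ ^ (k.natAbs ^ 2) * (E * E) * Real.cos (k * x) := by
    rw [heatKernel, ← tsum_mul_left]
    exact tsum_congr fun k => by ring
  rw [he]
  refine (tendsto_tsum_of_dominated_convergence
    (bound := fun k : ℤ => σ ^ (k.natAbs ^ 2) * ((eulerBound (σ ^ 2))⁻¹ * (eulerBound (σ ^ 2))⁻¹))
    (f := fun (N : ℕ) (k : ℤ) => tripleCoeff σ N k * Real.cos (k * x))
    ((summable_pow_natAbs_sq h0.le h1).mul_right _) (fun k => ?_) ?_).congr fun N =>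
      (hasSum_tripleCoeff h0 h1 x N).tsum_eq
  · refine ((hE.comp ?_).mul (hE.comp ?_)).const_mul _ |>.mul_const _
    · exact (tendsto_natCast_atTop_atTop (R := ℤ)).atTop_add (tendsto_const_nhds (x := -k))
    · exact (tendsto_natCast_atTop_atTop (R := ℤ)).atTop_add (tendsto_const_nhds (x := k))
  · refine .of_forall fun N k => ?_
    rw [norm_mul, tripleCoeff, norm_mul, norm_mul, Real.norm_of_nonneg (pow_nonneg h0.le _),
      Real.norm_of_nonneg (eulerInv_nonneg hQ0 hQ1 _),
      Real.norm_of_nonneg (eulerInv_nonneg hQ0 hQ1 _)]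
    refine (mul_le_of_le_one_right ?_ (Real.abs_cos_le_one _)).trans ?_
    · exact mul_nonneg (pow_nonneg h0.le _)
        (mul_nonneg (eulerInv_nonneg hQ0 hQ1 _) (eulerInv_nonneg hQ0 hQ1 _))
    · exact mul_le_mul_of_nonneg_left (mul_le_mul (eulerInv_le hQ0 hQ1 _) (eulerInv_le hQ0 hQ1 _)
        (eulerInv_nonneg hQ0 hQ1 _) (inv_nonneg.2 (eulerBound_pos _).le)) (pow_nonneg h0.le _)

theorem sq_le_tripleFactor {ρ c : ℝ} (h0 : 0 ≤ ρ) (hc : -1 ≤ c) :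
    (1 - ρ) ^ 2 ≤ 1 + 2 * ρ * c + ρ ^ 2 := by
  nlinarith [mul_nonneg h0 (by linarith : 0 ≤ c + 1)]

theorem tripleProd_nonneg {σ : ℝ} (h0 : 0 ≤ σ) (N : ℕ) {c : ℝ} (hc : -1 ≤ c) :
    0 ≤ tripleProd σ N c :=
  Finset.prod_nonneg fun _ _ => (sq_nonneg _).trans (sq_le_tripleFactor (pow_nonneg h0 _) hc)

/-- Every factor is nonnegative and nondecreasing in `c`. The first one contributes the increment
`2σ(c - d)`; each later one is at least its value `(1 - ρ)²` at `-1`, and `ρ = σ^(2i+1) ≤ σ^(i+1)`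
collects these values into an Euler product. -/
theorem le_tripleProd_sub {σ : ℝ} (h0 : 0 ≤ σ) (h1 : σ < 1) {c d : ℝ} (hd : -1 ≤ d) (hcd : d ≤ c)
    (N : ℕ) : 2 * σ * (c - d) * eulerProd σ (N + 1) ^ 2 ≤
      tripleProd σ (N + 1) c - tripleProd σ (N + 1) d := by
  induction N with
  | zero =>
    have h2 : eulerProd σ 1 ^ 2 ≤ 1 :=
      pow_le_one₀ (eulerProd_pos h0 h1 1).le (eulerProd_le_one h0 h1 1)
    have h3 : 0 ≤ 2 * σ * (c - d) := mul_nonneg (by positivity) (by linarith)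
    refine (mul_le_of_le_one_right h3 h2).trans_eq ?_
    simp [tripleProd]
    ring
  | succ N ih =>
    have ht : ∀ c, tripleProd σ (N + 1 + 1) c = tripleProd σ (N + 1) c *
        (1 + 2 * σ ^ (2 * (N + 1) + 1) * c + (σ ^ (2 * (N + 1) + 1)) ^ 2) := fun c =>
      Finset.prod_range_succ _ _
    have he : eulerProd σ (N + 1 + 1) = eulerProd σ (N + 1) * (1 - σ ^ (N + 1 + 1)) :=
      Finset.prod_range_succ _ _
    rw [ht, ht, he]
    set ρ := σ ^ (2 * (N + 1) + 1)
    have hρ : 0 ≤ ρ := pow_nonneg h0 _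
    have hρ' : ρ ≤ σ ^ (N + 1 + 1) := pow_le_pow_of_le_one h0 h1.le (by omega)
    have hs : σ ^ (N + 1 + 1) ≤ 1 := pow_le_one₀ h0 h1.le
    have hF := sq_le_tripleFactor hρ hd
    have hP := tripleProd_nonneg h0 (N + 1) (hd.trans hcd)
    have hX : 0 ≤ 2 * σ * (c - d) * eulerProd σ (N + 1) ^ 2 :=
      mul_nonneg (mul_nonneg (by positivity) (by linarith)) (sq_nonneg _)
    calc 2 * σ * (c - d) * (eulerProd σ (N + 1) * (1 - σ ^ (N + 1 + 1))) ^ 2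
        = (2 * σ * (c - d) * eulerProd σ (N + 1) ^ 2) * (1 - σ ^ (N + 1 + 1)) ^ 2 := by ring
      _ ≤ (2 * σ * (c - d) * eulerProd σ (N + 1) ^ 2) * (1 - ρ) ^ 2 :=
          mul_le_mul_of_nonneg_left (pow_le_pow_left₀ (by linarith) (by linarith) 2) hX
      _ ≤ (tripleProd σ (N + 1) c - tripleProd σ (N + 1) d) * (1 + 2 * ρ * d + ρ ^ 2) :=
          mul_le_mul ih hF (sq_nonneg _) (hX.trans ih)
      _ ≤ _ := by
          nlinarith [mul_nonneg hP (mul_nonneg hρ (by linarith : 0 ≤ c - d))]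

theorem heatKernel_nonneg {σ : ℝ} (h0 : 0 < σ) (h1 : σ < 1) (x : ℝ) : 0 ≤ heatKernel σ x := by
  have hQ0 : 0 ≤ σ ^ 2 := by positivity
  have hQ1 : σ ^ 2 < 1 := pow_lt_one₀ h0.le h1 two_ne_zero
  obtain ⟨E, hE0, -, hE⟩ := exists_tendsto_eulerInv hQ0 hQ1
  have := ge_of_tendsto' (tendsto_tripleProd h0 h1 hE x) fun N =>
    div_nonneg (tripleProd_nonneg h0.le N (Real.neg_one_le_cos x)) (eulerProd_pos hQ0 hQ1 _).le
  exact nonneg_of_mul_nonneg_right this (by positivity)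

/-- A positive lower bound for the rate of increase of the heat kernel as a function of `cos x`. -/
noncomputable def heatGap (σ : ℝ) : ℝ := eulerBound σ ^ 2 * eulerBound (σ ^ 2) ^ 2

theorem heatGap_pos (σ : ℝ) : 0 < heatGap σ :=
  mul_pos (pow_pos (eulerBound_pos _) 2) (pow_pos (eulerBound_pos _) 2)

theorem heatGap_anti {s σ : ℝ} (hs : 0 ≤ s) (h : s ≤ σ) (h1 : σ < 1) : heatGap σ ≤ heatGap s := by
  have h2 : s ^ 2 ≤ σ ^ 2 := pow_le_pow_left₀ hs h 2
  have h3 : σ ^ 2 < 1 := pow_lt_one₀ (hs.trans h) h1 two_ne_zero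
  exact mul_le_mul (pow_le_pow_left₀ (eulerBound_pos _).le (eulerBound_anti h h1) 2)
    (pow_le_pow_left₀ (eulerBound_pos _).le (eulerBound_anti h2 h3) 2) (sq_nonneg _) (sq_nonneg _)

theorem heatGap_le_one (σ : ℝ) : heatGap σ ≤ 1 := by
  have h : ∀ Q, eulerBound Q ≤ 1 := fun Q => Real.exp_le_one_iff.2 (neg_nonpos.2 (by positivity))
  exact mul_le_one₀ (pow_le_one₀ (eulerBound_pos _).le (h _)) (sq_nonneg _)
    (pow_le_one₀ (eulerBound_pos _).le (h _))

theorem le_heatKernel_sub {σ : ℝ} (h0 : 0 < σ) (h1 : σ < 1) {u v : ℝ}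
    (h : Real.cos v ≤ Real.cos u) :
    2 * σ * heatGap σ * (Real.cos u - Real.cos v) ≤ heatKernel σ u - heatKernel σ v := by
  have hQ0 : 0 ≤ σ ^ 2 := by positivity
  have hQ1 : σ ^ 2 < 1 := pow_lt_one₀ h0.le h1 two_ne_zero
  obtain ⟨E, hE0, hEb, hE⟩ := exists_tendsto_eulerInv hQ0 hQ1
  have ht := ((tendsto_tripleProd h0 h1 hE u).sub (tendsto_tripleProd h0 h1 hE v))
  have hc : 0 ≤ 2 * σ * (Real.cos u - Real.cos v) := mul_nonneg (by positivity) (by linarith)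
  have hlow : 2 * σ * (Real.cos u - Real.cos v) * eulerBound σ ^ 2 ≤
      E ^ 2 * heatKernel σ u - E ^ 2 * heatKernel σ v := by
    refine ge_of_tendsto ht ?_
    filter_upwards [eventually_ge_atTop 1] with N hN
    obtain ⟨M, rfl⟩ : ∃ M, N = M + 1 := ⟨N - 1, by omega⟩
    rw [← sub_div, le_div_iff₀ (eulerProd_pos hQ0 hQ1 _)]
    refine le_trans ?_ (le_tripleProd_sub h0.le h1 (Real.neg_one_le_cos v) h M)
    refine (mul_le_of_le_one_right (mul_nonneg hc (sq_nonneg _))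
      (eulerProd_le_one hQ0 hQ1 _)).trans ?_
    exact mul_le_mul_of_nonneg_left (pow_le_pow_left₀ (eulerBound_pos _).le
      (eulerBound_le_eulerProd h0.le h1 _) 2) hc
  -- `E` is at most `(eulerBound (σ ^ 2))⁻¹`, so the second factor of `heatGap` pays for dividing by
  -- `E ^ 2`.
  have hEE : eulerBound (σ ^ 2) * E ≤ 1 := by
    have := mul_le_mul_of_nonneg_left hEb (eulerBound_pos (σ ^ 2)).le
    rwa [mul_inv_cancel₀ (eulerBound_pos _).ne'] at this
  have hEE2 : (eulerBound (σ ^ 2) * E) ^ 2 ≤ 1 :=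
    pow_le_one₀ (mul_nonneg (eulerBound_pos _).le hE0.le) hEE
  have hE2 : 0 < E ^ 2 := by positivity
  rw [← mul_le_mul_iff_right₀ hE2]
  calc E ^ 2 * (2 * σ * heatGap σ * (Real.cos u - Real.cos v))
      = (2 * σ * (Real.cos u - Real.cos v) * eulerBound σ ^ 2) * (eulerBound (σ ^ 2) * E) ^ 2 := by
        rw [heatGap]; ring
    _ ≤ 2 * σ * (Real.cos u - Real.cos v) * eulerBound σ ^ 2 :=
        mul_le_of_le_one_right (mul_nonneg hc (sq_nonneg _)) hEE2
    _ ≤ _ := hlow.trans_eq (by ring)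

/-! ### Averages over a period -/

/-- Bounded measurable real functions. -/
def IsBoundedMeasurable (F : ℝ → ℝ) : Prop := Measurable F ∧ ∃ C, ∀ x, |F x| ≤ C

namespace IsBoundedMeasurable

variable {F G : ℝ → ℝ}

theorem mul (hF : IsBoundedMeasurable F) (hG : IsBoundedMeasurable G) :
    IsBoundedMeasurable fun x => F x * G x := by
  obtain ⟨hF, C, hC⟩ := hF
  obtain ⟨hG, D, hD⟩ := hG
  refine ⟨hF.mul hG, C * D, fun x => ?_⟩
  rw [abs_mul]
  exact mul_le_mul (hC x) (hD x) (abs_nonneg _) ((abs_nonneg _).trans (hC x))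

theorem sub (hF : IsBoundedMeasurable F) (hG : IsBoundedMeasurable G) :
    IsBoundedMeasurable fun x => F x - G x := by
  obtain ⟨hF, C, hC⟩ := hF
  obtain ⟨hG, D, hD⟩ := hG
  exact ⟨hF.sub hG, C + D, fun x => (abs_sub _ _).trans (add_le_add (hC x) (hD x))⟩

theorem comp (hF : IsBoundedMeasurable F) (hG : Measurable G) :
    IsBoundedMeasurable fun x => F (G x) := by
  obtain ⟨hF, C, hC⟩ := hF
  exact ⟨hF.comp hG, C, fun x => hC _⟩

theorem intervalIntegrable (hF : IsBoundedMeasurable F) (a b : ℝ) :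
    IntervalIntegrable F volume a b := by
  obtain ⟨hF, C, hC⟩ := hF
  rw [intervalIntegrable_iff]
  exact Measure.integrableOn_of_bounded (by simp) hF.aestronglyMeasurable
    (.of_forall fun x => hC x)

end IsBoundedMeasurable

theorem isBoundedMeasurable_const (a : ℝ) : IsBoundedMeasurable fun _ => a :=
  ⟨measurable_const, |a|, fun _ => le_rfl⟩

theorem isBoundedMeasurable_cos : IsBoundedMeasurable Real.cos :=
  ⟨Real.measurable_cos, 1, Real.abs_cos_le_one⟩

theorem isBoundedMeasurable_sin : IsBoundedMeasurable Real.sin :=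
  ⟨Real.measurable_sin, 1, Real.abs_sin_le_one⟩

theorem _root_.Monotone.isBoundedMeasurable_comp_cos {M : ℝ → ℝ} (hM : Monotone M) :
    IsBoundedMeasurable fun z => M (Real.cos z) := by
  refine ⟨hM.measurable.comp Real.measurable_cos, |M (-1)| + |M 1|, fun z => abs_le.2 ⟨?_, ?_⟩⟩
  · have := hM (Real.neg_one_le_cos z)
    linarith [neg_abs_le (M (-1)), abs_nonneg (M 1)]
  · have := hM (Real.cos_le_one z)
    linarith [le_abs_self (M 1), abs_nonneg (M (-1))]

theorem mean_mono {F G : ℝ → ℝ} (hF : IsBoundedMeasurable F) (hG : IsBoundedMeasurable G)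
    (h : ∀ x, F x ≤ G x) : mean F ≤ mean G :=
  mul_le_mul_of_nonneg_left (intervalIntegral.integral_mono (by linarith [Real.pi_pos])
    (hF.intervalIntegrable _ _) (hG.intervalIntegrable _ _) h) (by positivity)

theorem mean_sub {F G : ℝ → ℝ} (hF : IsBoundedMeasurable F) (hG : IsBoundedMeasurable G) :
    mean (fun x => F x - G x) = mean F - mean G := by
  rw [mean, intervalIntegral.integral_sub (hF.intervalIntegrable _ _) (hG.intervalIntegrable _ _),
    mul_sub, mean, mean]

theorem mean_const_mul (a : ℝ) (F : ℝ → ℝ) : mean (fun x => a * F x) = a * mean F := by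
  rw [mean, intervalIntegral.integral_const_mul, mean, mul_left_comm]

theorem mean_const (a : ℝ) : mean (fun _ => a) = a := by
  rw [mean, intervalIntegral.integral_const, smul_eq_mul]
  have := Real.pi_ne_zero
  field_simp
  ring

theorem mean_comp_sub {F : ℝ → ℝ} (hF : Function.Periodic F (2 * Real.pi)) (x : ℝ) :
    mean (fun z => F (x - z)) = mean F := by
  have h := hF.intervalIntegral_add_eq (x - Real.pi) (-Real.pi)
  rw [mean, mean, intervalIntegral.integral_comp_sub_left]
  rw [show x - Real.pi + 2 * Real.pi = x - -Real.pi by ring,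
    show -Real.pi + 2 * Real.pi = Real.pi by ring] at h
  rw [h]

theorem mean_eq_zero_of_odd {F : ℝ → ℝ} (hF : ∀ x, F (-x) = -F x) : mean F = 0 := by
  have h : ∫ z in (-Real.pi)..Real.pi, F (-z) = ∫ z in (-Real.pi)..Real.pi, F z := by
    rw [intervalIntegral.integral_comp_neg, neg_neg]
  simp only [hF, intervalIntegral.integral_neg] at h
  rw [mean, show ∫ z in (-Real.pi)..Real.pi, F z = 0 by linarith, mul_zero]

/-- The averages against a difference of even kernels in symmetrized form. -/
theorem mean_mul_sub_symm {F K : ℝ → ℝ} (hF : IsBoundedMeasurable F) (hK : IsBoundedMeasurable K)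
    (hFp : Function.Periodic F (2 * Real.pi)) (hKp : Function.Periodic K (2 * Real.pi)) (x : ℝ) :
    mean (fun z => (F z - F (x - z)) * (K z - K (x - z))) =
      2 * mean fun z => F z * (K z - K (x - z)) := by
  have hm : Measurable fun z : ℝ => x - z := by fun_prop
  have hD := hK.sub (hK.comp hm)
  have h1 := mean_comp_sub (F := fun z => F z * (K z - K (x - z))) (fun z => by
    have e : x - (z + 2 * Real.pi) = x - z - 2 * Real.pi := by ring
    simp only [hFp z, hKp z, e, hKp.sub_eq]) x
  simp only [sub_sub_cancel] at h1
  have h2 : (fun z => (F z - F (x - z)) * (K z - K (x - z))) =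
      fun z => F z * (K z - K (x - z)) - (-1) * (F (x - z) * (K (x - z) - K z)) := by
    ext z; ring
  rw [h2, mean_sub (hF.mul hD), mean_const_mul, h1]
  · ring
  · refine (isBoundedMeasurable_const (-1)).mul ((hF.comp hm).mul ((hK.comp hm).sub hK))

/-! ### Heat flow of profiles monotone in `cos x` -/

/-- Cosine coefficients of `z ↦ M (cos z)`. -/
noncomputable def cosCoeff (M : ℝ → ℝ) (k : ℤ) : ℝ :=
  mean fun z => M (Real.cos z) * Real.cos (k * z)

theorem isBoundedMeasurable_cos_int_mul (k : ℤ) :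
    IsBoundedMeasurable fun z => Real.cos (k * z) :=
  isBoundedMeasurable_cos.comp (by fun_prop)

theorem cosCoeff_mul_one_sub_cos {M : ℝ → ℝ} (hM : Monotone M) (k : ℤ) (x : ℝ) :
    mean (fun z => M (Real.cos z) * (Real.cos (k * z) - Real.cos (k * (x - z)))) =
      cosCoeff M k * (1 - Real.cos (k * x)) := by
  have hF := hM.isBoundedMeasurable_comp_cos
  have hc := hF.mul (isBoundedMeasurable_cos_int_mul k)
  have hs : IsBoundedMeasurable fun z => M (Real.cos z) * Real.sin (k * z) :=
    hF.mul (isBoundedMeasurable_sin.comp (by fun_prop))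
  have h0 : mean (fun z => M (Real.cos z) * Real.sin (k * z)) = 0 :=
    mean_eq_zero_of_odd fun z => by simp
  have e : (fun z => M (Real.cos z) * (Real.cos (k * z) - Real.cos (k * (x - z)))) =
      fun z => (1 - Real.cos (k * x)) * (M (Real.cos z) * Real.cos (k * z)) -
        Real.sin (k * x) * (M (Real.cos z) * Real.sin (k * z)) := by
    ext z
    rw [mul_sub (k : ℝ) x z, Real.cos_sub]
    ring
  rw [e, mean_sub ((isBoundedMeasurable_const _).mul hc) ((isBoundedMeasurable_const _).mul hs),
    mean_const_mul, mean_const_mul, h0, cosCoeff]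
  ring

theorem norm_heatTerm_le {σ : ℝ} (h0 : 0 ≤ σ) (k : ℤ) (x : ℝ) :
    ‖σ ^ (k.natAbs ^ 2) * Real.cos (k * x)‖ ≤ σ ^ (k.natAbs ^ 2) := by
  rw [norm_mul, Real.norm_of_nonneg (pow_nonneg h0 _)]
  exact mul_le_of_le_one_right (pow_nonneg h0 _) (Real.abs_cos_le_one _)

theorem hasSum_heatKernel {σ : ℝ} (h0 : 0 ≤ σ) (h1 : σ < 1) (x : ℝ) :
    HasSum (fun k : ℤ => σ ^ (k.natAbs ^ 2) * Real.cos (k * x)) (heatKernel σ x) :=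
  (Summable.of_norm_bounded (summable_pow_natAbs_sq h0 h1) fun k => norm_heatTerm_le h0 k x).hasSum

theorem isBoundedMeasurable_heatKernel {σ : ℝ} (h0 : 0 ≤ σ) (h1 : σ < 1) :
    IsBoundedMeasurable (heatKernel σ) := by
  refine ⟨Continuous.measurable ?_, ∑' k : ℤ, σ ^ (k.natAbs ^ 2), fun x => ?_⟩
  · exact continuous_tsum (fun k => by fun_prop) (summable_pow_natAbs_sq h0 h1)
      fun k x => norm_heatTerm_le h0 k x
  · exact tsum_of_norm_bounded (summable_pow_natAbs_sq h0 h1).hasSum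
      fun k => norm_heatTerm_le h0 k x

theorem heatKernel_periodic (σ : ℝ) : Function.Periodic (heatKernel σ) (2 * Real.pi) := fun x => by
  refine tsum_congr fun k => ?_
  rw [mul_add, Real.cos_add_int_mul_two_pi]

theorem hasSum_mean_mul_heatKernel {F : ℝ → ℝ} (hF : IsBoundedMeasurable F) {σ : ℝ} (h0 : 0 ≤ σ)
    (h1 : σ < 1) {g : ℝ → ℝ} (hg : Measurable g) :
    HasSum (fun k : ℤ => σ ^ (k.natAbs ^ 2) * mean fun z => F z * Real.cos (k * g z))
      (mean fun z => F z * heatKernel σ (g z)) := by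
  obtain ⟨C, hC⟩ := hF.2
  have hs := summable_pow_natAbs_sq h0 h1
  have hm : ∀ k : ℤ, Measurable fun z => F z * (σ ^ (k.natAbs ^ 2) * Real.cos (k * g z)) := by
    intro k
    have := hF.1
    fun_prop
  have := (intervalIntegral.hasSum_integral_of_dominated_convergence
    (a := -Real.pi) (b := Real.pi) (μ := volume)
    (F := fun (k : ℤ) z => F z * (σ ^ (k.natAbs ^ 2) * Real.cos (k * g z)))
    (f := fun z => F z * heatKernel σ (g z)) (fun k _ => C * σ ^ (k.natAbs ^ 2))
    (fun k => (hm k).aestronglyMeasurable)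
    (fun k => .of_forall fun z _ => ?_) (.of_forall fun z _ => hs.mul_left C)
    intervalIntegrable_const
    (.of_forall fun z _ => (hasSum_heatKernel h0 h1 (g z)).mul_left (F z))).mul_left
      ((2 * Real.pi)⁻¹)
  · refine this.congr_fun fun k => ?_
    rw [← mean_const_mul, mean]
    congr 1
    exact intervalIntegral.integral_congr fun z _ => by ring
  · rw [norm_mul]
    exact mul_le_mul (hC z) (norm_heatTerm_le h0 k _) (norm_nonneg _)
      ((abs_nonneg _).trans (hC z))

theorem hasSum_heat_diff {M : ℝ → ℝ} (hM : Monotone M) {σ : ℝ} (h0 : 0 ≤ σ) (h1 : σ < 1) (x : ℝ) :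
    HasSum (fun k : ℤ => σ ^ (k.natAbs ^ 2) * (cosCoeff M k * (1 - Real.cos (k * x))))
      (mean fun z => M (Real.cos z) * (heatKernel σ z - heatKernel σ (x - z))) := by
  have hF := hM.isBoundedMeasurable_comp_cos
  have hK := isBoundedMeasurable_heatKernel h0 h1
  have hm : Measurable fun z : ℝ => x - z := by fun_prop
  have h := (hasSum_mean_mul_heatKernel hF h0 h1 measurable_id).sub
    (hasSum_mean_mul_heatKernel hF h0 h1 hm)
  rw [← mean_sub (hF.mul (hK.comp measurable_id)) (hF.mul (hK.comp hm))] at h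
  simp only [← mul_sub, id] at h
  refine h.congr_fun fun k => ?_
  rw [← cosCoeff_mul_one_sub_cos hM, ← mean_sub (hF.mul (isBoundedMeasurable_cos_int_mul k))
    (hF.mul ((isBoundedMeasurable_cos_int_mul k).comp hm))]
  simp only [mul_sub]

/-- The heat flow decreases away from the crest at a definite rate. -/
theorem le_heat_diff {M : ℝ → ℝ} (hM : Monotone M) {σ : ℝ} (h0 : 0 < σ) (h1 : σ < 1) (x : ℝ) :
    2 * σ * heatGap σ * (cosCoeff M 1 * (1 - Real.cos x)) ≤
      mean fun z => M (Real.cos z) * (heatKernel σ z - heatKernel σ (x - z)) := by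
  have hF := hM.isBoundedMeasurable_comp_cos
  have hK := isBoundedMeasurable_heatKernel h0.le h1
  have hFp : Function.Periodic (fun z => M (Real.cos z)) (2 * Real.pi) := fun z => by simp
  have hm : Measurable fun z : ℝ => x - z := by fun_prop
  have e1 := mean_mul_sub_symm hF hK hFp (heatKernel_periodic σ) x
  have e2 := mean_mul_sub_symm hF isBoundedMeasurable_cos hFp Real.cos_periodic x
  have e3 := cosCoeff_mul_one_sub_cos hM 1 x
  simp only [Int.cast_one, one_mul] at e3
  rw [e3] at e2
  -- The differences of `M ∘ cos`, of the kernel and of `cos` have compatible signs, so the kernel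
  -- difference may be replaced by a multiple of the cosine difference; against the cosine kernel
  -- only the first coefficient survives.
  have key : mean (fun z => (2 * σ * heatGap σ) *
      ((M (Real.cos z) - M (Real.cos (x - z))) * (Real.cos z - Real.cos (x - z)))) ≤
      mean (fun z => (M (Real.cos z) - M (Real.cos (x - z))) *
        (heatKernel σ z - heatKernel σ (x - z))) := by
    refine mean_mono ((isBoundedMeasurable_const _).mul ((hF.sub (hF.comp hm)).mul
      (isBoundedMeasurable_cos.sub (isBoundedMeasurable_cos.comp hm))))
      ((hF.sub (hF.comp hm)).mul (hK.sub (hK.comp hm))) fun z => ?_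
    rcases le_total (Real.cos (x - z)) (Real.cos z) with h | h
    · have := mul_le_mul_of_nonneg_left (le_heatKernel_sub h0 h1 h) (sub_nonneg.2 (hM h))
      linarith
    · have := mul_le_mul_of_nonneg_left (le_heatKernel_sub h0 h1 h) (sub_nonneg.2 (hM h))
      linarith
  rw [mean_const_mul, e1, e2] at key
  linarith

theorem mean_cos_int_mul {k : ℤ} (hk : k ≠ 0) : mean (fun z => Real.cos (k * z)) = 0 := by
  have hk' : (k : ℝ) ≠ 0 := by exact_mod_cast hk
  rw [mean, intervalIntegral.integral_comp_mul_left _ hk', integral_cos]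
  simp [Real.sin_int_mul_pi]

theorem mean_heatKernel {σ : ℝ} (h0 : 0 ≤ σ) (h1 : σ < 1) : mean (heatKernel σ) = 1 := by
  have h := hasSum_mean_mul_heatKernel (isBoundedMeasurable_const 1) h0 h1 measurable_id
  simp only [one_mul, id] at h
  have h2 := hasSum_single (f := fun k : ℤ =>
    σ ^ (k.natAbs ^ 2) * mean fun z => Real.cos (k * z)) 0
    fun k hk => by rw [mean_cos_int_mul hk, mul_zero]
  rw [h.unique h2]
  simp [mean_const]

theorem mean_cos_mul_cos (k : ℤ) : mean (fun z => Real.cos z * Real.cos (k * z)) =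
    if k.natAbs = 1 then 1 / 2 else 0 := by
  have e : (fun z => Real.cos z * Real.cos (k * z)) = fun z => (1 / 2) * Real.cos ((k + 1 : ℤ) * z) -
      (-1 / 2) * Real.cos ((k - 1 : ℤ) * z) := by
    ext z
    have e1 : ((k + 1 : ℤ) : ℝ) * z = k * z + z := by push_cast; ring
    have e2 : ((k - 1 : ℤ) : ℝ) * z = k * z - z := by push_cast; ring
    simp only [e1, e2, Real.cos_add, Real.cos_sub]
    ring
  rw [e, mean_sub ((isBoundedMeasurable_const _).mul (isBoundedMeasurable_cos_int_mul _))
    ((isBoundedMeasurable_const _).mul (isBoundedMeasurable_cos_int_mul _)), mean_const_mul,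
    mean_const_mul]
  have h0 : mean (fun z => Real.cos ((0 : ℤ) * z)) = 1 := by simp [mean_const]
  split_ifs with h
  · rcases Int.natAbs_eq k with h' | h' <;> rw [h] at h' <;> subst h'
    · rw [mean_cos_int_mul (by norm_num), show ((1 : ℕ) - 1 : ℤ) = 0 by norm_num, h0]
      norm_num
    · rw [mean_cos_int_mul (k := -((1 : ℕ) : ℤ) - 1) (by norm_num),
        show (-((1 : ℕ) : ℤ) + 1 : ℤ) = 0 by norm_num, h0]
      norm_num
  · rw [mean_cos_int_mul (by omega), mean_cos_int_mul (by omega)]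
    ring

theorem mean_cos_mul_heatKernel {σ : ℝ} (h0 : 0 ≤ σ) (h1 : σ < 1) :
    mean (fun z => Real.cos z * heatKernel σ z) = σ := by
  have h := hasSum_mean_mul_heatKernel isBoundedMeasurable_cos h0 h1 measurable_id
  simp only [id, mean_cos_mul_cos] at h
  have h2 := hasSum_sum_of_ne_finset_zero (L := .unconditional ℤ) (s := ({1, -1} : Finset ℤ))
    (f := fun k : ℤ => σ ^ (k.natAbs ^ 2) * if k.natAbs = 1 then 1 / 2 else (0 : ℝ)) fun k hk => by
      simp only [Finset.mem_insert, Finset.mem_singleton] at hk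
      rw [if_neg (by omega), mul_zero]
  rw [h.unique h2, Finset.sum_pair (by norm_num)]
  norm_num
  ring

/-- The heat flow of a profile is controlled by nearby values of the profile. -/
theorem heat_diff_le {N : ℝ → ℝ} (hN : Monotone N) {σ : ℝ} (h0 : 0 < σ) (h1 : σ < 1) {x η : ℝ}
    (hx : 0 ≤ x) (hη : 0 < η) (hxη : x + η ≤ Real.pi) :
    mean (fun z => N (Real.cos z) * (heatKernel σ z - heatKernel σ (x - z))) ≤
      N 1 - N (Real.cos (x + η)) + (N 1 - N (-1)) / (1 - Real.cos η) * (1 - σ) := by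
  have hF := hN.isBoundedMeasurable_comp_cos
  have hK := isBoundedMeasurable_heatKernel h0.le h1
  have hm : Measurable fun z : ℝ => x - z := by fun_prop
  have hcη : 0 < 1 - Real.cos η := by
    have := Real.cos_lt_cos_of_nonneg_of_le_pi le_rfl (by linarith) hη
    rw [Real.cos_zero] at this
    linarith
  have hflip : mean (fun z => N (Real.cos z) * heatKernel σ (x - z)) =
      mean fun z => N (Real.cos (x - z)) * heatKernel σ z := by
    have := mean_comp_sub (F := fun z => N (Real.cos z) * heatKernel σ (x - z)) (fun z => by
      have e : x - (z + 2 * Real.pi) = x - z - 2 * Real.pi := by ring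
      simp only [Real.cos_add_two_pi, e, (heatKernel_periodic σ).sub_eq]) x
    simp only [sub_sub_cancel] at this
    exact this.symm
  set A := N 1 - N (Real.cos (x + η))
  set B := (N 1 - N (-1)) / (1 - Real.cos η) with hB
  have hA0 : 0 ≤ A := sub_nonneg.2 (hN (Real.cos_le_one _))
  have hB0 : 0 ≤ B := div_nonneg (sub_nonneg.2 (hN (by norm_num))) hcη.le
  -- If `cos z ≥ cos η`, then `x - z` lies within `x + η` of zero modulo the period and `A`
  -- suffices. Otherwise `B (1 - cos z)` exceeds the whole oscillation of `N`. Averaging `1 - cos z`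
  -- against the kernel gives `1 - σ`.
  have hpt : ∀ z, N (Real.cos z) - N (Real.cos (x - z)) ≤ A - B * (Real.cos z - 1) := by
    intro z
    have h3 : N (Real.cos z) ≤ N 1 := hN (Real.cos_le_one z)
    rcases le_or_gt (Real.cos η) (Real.cos z) with h | h
    · obtain ⟨y, hy, hyz⟩ : ∃ y ∈ Icc 0 Real.pi, Real.cos y = Real.cos z :=
        ⟨Real.arccos (Real.cos z), ⟨Real.arccos_nonneg _, Real.arccos_le_pi _⟩,
          Real.cos_arccos (Real.neg_one_le_cos z) (Real.cos_le_one z)⟩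
      have hyη : y ≤ η := by
        by_contra! hlt
        have := Real.cos_lt_cos_of_nonneg_of_le_pi hη.le hy.2 hlt
        linarith
      have hcos : Real.cos (x + η) ≤ Real.cos (x - z) := by
        obtain ⟨k, hk | hk⟩ := Real.cos_eq_cos_iff.1 hyz
        · rw [hk, show x - (2 * k * Real.pi + y) = x - y - k * (2 * Real.pi) by ring,
            Real.cos_sub_int_mul_two_pi, ← Real.cos_abs (x - y)]
          exact Real.cos_le_cos_of_nonneg_of_le_pi (abs_nonneg _) hxη
            (abs_le.2 ⟨by linarith [hy.1], by linarith [hy.1]⟩)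
        · rw [hk, show x - (2 * k * Real.pi - y) = x + y - k * (2 * Real.pi) by ring,
            Real.cos_sub_int_mul_two_pi]
          exact Real.cos_le_cos_of_nonneg_of_le_pi (by linarith [hy.1]) hxη (by linarith)
      have h4 := hN hcos
      have h5 := mul_nonneg hB0 (by linarith [Real.cos_le_one z] : 0 ≤ 1 - Real.cos z)
      simp only [A]
      linarith
    · have h4 : N (-1) ≤ N (Real.cos (x - z)) := hN (Real.neg_one_le_cos _)
      have h5 : N 1 - N (-1) ≤ B * (1 - Real.cos z) := by
        have := mul_le_mul_of_nonneg_left (by linarith : 1 - Real.cos η ≤ 1 - Real.cos z) hB0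
        rwa [hB, div_mul_cancel₀ _ hcη.ne'] at this
      linarith
  have hR : mean (fun z => (A + B) * heatKernel σ z - B * (Real.cos z * heatKernel σ z)) =
      A + B * (1 - σ) := by
    rw [mean_sub ((isBoundedMeasurable_const _).mul hK)
      ((isBoundedMeasurable_const _).mul (isBoundedMeasurable_cos.mul hK)), mean_const_mul,
      mean_const_mul, mean_heatKernel h0.le h1, mean_cos_mul_heatKernel h0.le h1]
    ring
  rw [← hR]
  simp only [mul_sub]
  rw [mean_sub (hF.mul hK) (hF.mul (hK.comp hm)), hflip, ← mean_sub (hF.mul hK) ((hF.comp hm).mul hK)]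
  refine mean_mono ((hF.mul hK).sub ((hF.comp hm).mul hK)) (((isBoundedMeasurable_const _).mul hK).sub
    ((isBoundedMeasurable_const _).mul (isBoundedMeasurable_cos.mul hK))) fun z => ?_
  have := mul_le_mul_of_nonneg_right (hpt z) (heatKernel_nonneg h0 h1 z)
  linarith

/-- Subtracting `M 0` makes the integrand nonnegative for monotone `M`. -/
theorem cosCoeff_one_eq {M : ℝ → ℝ} (hM : Monotone M) :
    cosCoeff M 1 = mean fun z => (M (Real.cos z) - M 0) * Real.cos z := by
  have hF := hM.isBoundedMeasurable_comp_cos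
  simp only [sub_mul]
  have h0 : mean (fun z => Real.cos z) = 0 := by simpa using mean_cos_int_mul one_ne_zero
  rw [mean_sub (hF.mul isBoundedMeasurable_cos)
    ((isBoundedMeasurable_const _).mul isBoundedMeasurable_cos), mean_const_mul, h0]
  simp [cosCoeff]

theorem _root_.Monotone.sub_mul_self_nonneg {M : ℝ → ℝ} (hM : Monotone M) (c : ℝ) :
    0 ≤ (M c - M 0) * c := by
  rcases le_total 0 c with h | h
  · exact mul_nonneg (sub_nonneg.2 (hM h)) h
  · exact mul_nonneg_of_nonpos_of_nonpos (sub_nonpos.2 (hM h)) h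

theorem cosCoeff_one_nonneg {M : ℝ → ℝ} (hM : Monotone M) : 0 ≤ cosCoeff M 1 := by
  rw [cosCoeff_one_eq hM]
  refine (mean_const 0).symm.trans_le ?_
  exact mean_mono (isBoundedMeasurable_const 0) ((hM.isBoundedMeasurable_comp_cos.sub
    (isBoundedMeasurable_const _)).mul isBoundedMeasurable_cos) fun z => hM.sub_mul_self_nonneg _

/-- The exceptional set is invariant under the period and null in a fundamental domain. -/
theorem ae_of_periodic_of_ae_Ioc {p : ℝ → Prop} (hp : ∀ x, p (x + 2 * Real.pi) ↔ p x)
    (h : ∀ᵐ x ∂volume.restrict (Ioc (-Real.pi) Real.pi), p x) : ∀ᵐ x, p x := by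
  have hd := isAddFundamentalDomain_Ioc Real.two_pi_pos (-Real.pi)
  rw [show -Real.pi + 2 * Real.pi = Real.pi by ring] at hd
  have hper : Function.Periodic p (2 * Real.pi) := fun x => propext (hp x)
  rw [ae_iff]
  refine hd.measure_zero_of_invariant _ ?_ ?_
  · rintro ⟨g, n, rfl⟩
    ext x
    rw [mem_vadd_set_iff_neg_vadd_mem]
    have e : (-(⟨(fun n : ℤ => n • (2 * Real.pi)) n, ⟨n, rfl⟩⟩ :
        AddSubgroup.zmultiples (2 * Real.pi))) +ᵥ x = x - n • (2 * Real.pi) := by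
      change -(n • (2 * Real.pi)) + x = _
      ring
    rw [e]
    simp only [mem_ofPred_eq, hper.sub_zsmul_eq n]
  · have h' := ae_iff.1 h
    rwa [Measure.restrict_apply' measurableSet_Ioc] at h'

theorem ae_eq_of_cosCoeff_one_eq_zero {M : ℝ → ℝ} (hM : Monotone M) (h : cosCoeff M 1 = 0) :
    ∀ᵐ x, M (Real.cos x) = M 0 := by
  refine ae_of_periodic_of_ae_Ioc (fun x => by simp) ?_
  have hG : IsBoundedMeasurable fun z => (M (Real.cos z) - M 0) * Real.cos z :=
    (hM.isBoundedMeasurable_comp_cos.sub (isBoundedMeasurable_const _)).mul isBoundedMeasurable_cos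
  rw [cosCoeff_one_eq hM, mean, mul_eq_zero_iff_left (by positivity),
    intervalIntegral.integral_eq_zero_iff_of_le_of_nonneg_ae (by linarith [Real.pi_pos])
      (.of_forall fun z => hM.sub_mul_self_nonneg _) (hG.intervalIntegrable _ _)] at h
  filter_upwards [h] with z hz
  rcases mul_eq_zero.1 hz with h1 | h1
  · linarith
  · rw [h1]

/-! ### The symbols as decaying moment sequences in `k²` -/

theorem AssumptionS.exists_isCompletelyMonotone {m : ℤ → ℝ} (hm : ∀ k : ℤ, m (-k) = m k)
    (h : AssumptionS m) : ∃ a : ℕ → ℝ, IsCompletelyMonotone a ∧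
      (∀ k : ℤ, k ≠ 0 → m k = a (k.natAbs ^ 2 - 1)) ∧ ∀ ε > 0, ∃ j, a j < ε := by
  obtain ⟨r, hr, hsym, M, hM, hcm⟩ := h
  have hval : ∀ k : ℤ, k ≠ 0 → m k = M (Real.sqrt ((k.natAbs ^ 2 - 1 + 1 : ℕ) : ℝ)) := by
    intro k hk
    have h1 : 1 ≤ k.natAbs ^ 2 := Nat.one_le_pow _ _ (Int.natAbs_pos.2 hk)
    rw [Nat.sub_add_cancel h1, Nat.cast_pow, Real.sqrt_sq (Nat.cast_nonneg _)]
    have h2 := hM (k.natAbs : ℤ)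
    rw [Int.cast_natCast] at h2
    rw [h2]
    rcases Int.natAbs_eq k with h | h
    · rw [← h]
    · rw [h, hm]; simp
  refine ⟨_, hcm, hval, fun ε hε => ?_⟩
  obtain ⟨C, hC⟩ := hsym 0
  have hlim : Tendsto (fun n : ℕ => C * (1 + (n : ℝ)) ^ r) atTop (𝓝 0) := by
    have h1 := (tendsto_rpow_neg_atTop (neg_pos.2 hr)).comp
      (tendsto_atTop_add_const_left atTop (1 : ℝ) tendsto_natCast_atTop_atTop)
    simpa using h1.const_mul C
  obtain ⟨n, hn, hn1⟩ := ((hlim.eventually_lt_const hε).and (eventually_ge_atTop 1)).exists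
  refine ⟨n ^ 2 - 1, ?_⟩
  have h1 := hC n
  simp only [Function.iterate_zero, id, Nat.cast_zero, sub_zero, Int.cast_natCast, Nat.abs_cast]
    at h1
  have h2 := hval n (by omega)
  rw [Int.natAbs_natCast] at h2
  change M (Real.sqrt ((n ^ 2 - 1 + 1 : ℕ) : ℝ)) < ε
  rw [← h2]
  exact (le_abs_self _).trans_lt (h1.trans_lt hn)

theorem AssumptionH.exists_isCompletelyMonotone {m : ℤ → ℝ} (hm : ∀ k : ℤ, m (-k) = m k)
    (h : AssumptionH m) : ∃ a : ℕ → ℝ, IsCompletelyMonotone a ∧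
      (∀ k : ℤ, k ≠ 0 → m k = a (k.natAbs ^ 2 - 1)) ∧ ∀ ε > 0, ∃ j, a j < ε := by
  obtain ⟨r, hr, hhom, b, _, hb, -, hbd⟩ := h
  have hm1 : 0 ≤ m 1 := le_trans (by simpa using hb.le) (hbd 1 one_ne_zero).1
  -- Here `|k|^r = (k²)^(r/2)`, and index `j` stands for `k² = j + 1`.
  refine ⟨fun j => m 1 * ((j + 1 : ℕ) : ℝ) ^ (-(-r / 2)),
    (isCompletelyMonotone_rpow (by linarith)).const_mul hm1, fun k hk => ?_, fun ε hε => ?_⟩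
  · have hpos : 0 < k.natAbs := Int.natAbs_pos.2 hk
    have h1 : 1 ≤ k.natAbs ^ 2 := Nat.one_le_pow _ _ hpos
    have h2 := hhom k.natAbs hpos 1 one_ne_zero
    have h3 : m k = m ((k.natAbs : ℤ) * 1) := by
      rw [mul_one]
      rcases Int.natAbs_eq k with h | h
      · rw [← h]
      · rw [h, hm]; simp
    rw [h3, h2]
    simp only
    rw [Nat.sub_add_cancel h1, Nat.cast_pow, ← Real.rpow_natCast,
      ← Real.rpow_mul (Nat.cast_nonneg _), mul_comm]
    congr 2
    push_cast
    ring
  · have h1 := (tendsto_rpow_neg_atTop (y := -r / 2) (by linarith)).comp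
      ((tendsto_natCast_atTop_atTop (R := ℝ)).comp (tendsto_add_atTop_nat 1))
    have h2 : Tendsto (fun j : ℕ => m 1 * ((j + 1 : ℕ) : ℝ) ^ (-(-r / 2))) atTop (𝓝 0) := by
      simpa using h1.const_mul (m 1)
    exact (h2.eventually_lt_const hε).exists

/-! ### Quadratic drop of `L φ` from the crest -/

/-- A profile with a multiplier image given by a decaying moment sequence has an image which
decreases at least quadratically away from the crest. -/
theorem exists_mul_one_sub_cos_le {M N : ℝ → ℝ} (hM : Monotone M) (hN : Monotone N) {a : ℕ → ℝ}
    (ha : IsCompletelyMonotone a) (hdecay : ∀ ε > 0, ∃ j, a j < ε)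
    (hMN : ∀ k : ℤ, k ≠ 0 → cosCoeff N k = a (k.natAbs ^ 2 - 1) * cosCoeff M k)
    (hM1 : cosCoeff M 1 ≠ 0) (hN1 : cosCoeff N 1 ≠ 0) :
    ∃ ε > 0, ∀ y, 0 < y → y ≤ Real.pi → ε * (1 - Real.cos (y / 2)) ≤ N 1 - N (Real.cos y) := by
  have hb : 0 < cosCoeff M 1 := lt_of_le_of_ne (cosCoeff_one_nonneg hM) hM1.symm
  have ha0 : 0 < a 0 := by
    refine lt_of_le_of_ne (ha.nonneg 0) fun h => hN1 ?_
    simpa [← h] using hMN 1 one_ne_zero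
  -- Decay excludes a measure concentrated at `s = 1`, where the heat gap degenerates.
  obtain ⟨J, hJ⟩ := hdecay (a 0 / 2) (by linarith)
  -- `s₀ = 1 - 1/(2(J+1))`, by Bernoulli's inequality.
  obtain ⟨s₀, hs0, hs1, hsJ⟩ : ∃ s₀ : ℝ, 0 < s₀ ∧ s₀ < 1 ∧ 1 / 2 < s₀ ^ J := by
    have hd : 0 < (2 * ((J : ℝ) + 1))⁻¹ := by positivity
    have hd1 : (2 * ((J : ℝ) + 1))⁻¹ ≤ 1 / 2 := by
      rw [inv_le_comm₀ (by positivity) (by norm_num)]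
      have : (0 : ℝ) ≤ J := by positivity
      norm_num
    refine ⟨1 + -(2 * ((J : ℝ) + 1))⁻¹, by linarith, by linarith, ?_⟩
    refine lt_of_lt_of_le ?_ (one_add_mul_le_pow (by linarith) J)
    have : (J : ℝ) * (2 * ((J : ℝ) + 1))⁻¹ < 1 / 2 := by
      rw [← div_eq_mul_inv, div_lt_div_iff₀ (by positivity) (by norm_num)]
      linarith
    linarith
  set κ := 2 * heatGap s₀ * cosCoeff M 1
  have hκ : 0 < κ := by have := heatGap_pos s₀; positivity
  refine ⟨κ * (a 0 - 2 * a J), mul_pos hκ (by linarith), fun y hy hyπ => ?_⟩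
  set x := y / 2 with hx
  have hcx : 0 ≤ 1 - Real.cos x := by linarith [Real.cos_le_one x]
  set C := (N 1 - N (-1)) / (1 - Real.cos x)
  have main : ∀ q ∈ Ioo (0 : ℝ) 1,
      q * (κ * (a 0 - 2 * a J) * (1 - Real.cos x)) ≤ N 1 - N (Real.cos y) + C * (1 - q) := by
    rintro q ⟨hq0, hq1⟩
    -- Halving `y` leaves room for the kernel's width: `x = η = y/2` gives `x + η = y ≤ π`.
    have hup := heat_diff_le hN hq0 hq1 (x := x) (η := x) (by linarith) (by linarith) (by linarith)
    rw [show x + x = y by rw [hx]; ring] at hup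
    refine le_trans ?_ hup
    rw [← (hasSum_heat_diff hN hq0.le hq1 x).tsum_eq]
    set u : ℤ → ℝ := fun k =>
      q ^ (k.natAbs ^ 2) * (cosCoeff M k * (1 - Real.cos (k * x))) with hu
    have hu0 : u 0 = 0 := by simp [hu]
    have hueq : ∀ k : ℤ, q ^ (k.natAbs ^ 2) * (cosCoeff N k * (1 - Real.cos (k * x))) =
        u k * a (k.natAbs ^ 2 - 1) := by
      intro k
      rcases eq_or_ne k 0 with rfl | hk
      · simp [hu0]
      · rw [hMN k hk]; ring
    rw [tsum_congr hueq]
    set α := q * (κ * (1 - Real.cos x))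
    have hα : 0 ≤ α := mul_nonneg hq0.le (mul_nonneg hκ.le hcx)
    have hsJ0 : 0 < s₀ ^ J := by positivity
    -- The minorant `α - β s^J` is at most `α`, which suffices for `s ≤ s₀`, and is nonpositive for
    -- `s > s₀`. As `β ≤ 2α`, the moments leave `α (a 0 - 2 a J) > 0` when `α > 0`.
    have key := ha.le_tsum_mul (u := u) (e := fun k => k.natAbs ^ 2 - 1) (α := α)
      (β := α / s₀ ^ J) (J := J) (hasSum_heat_diff hM hq0.le hq1 x).summable.abs ?_
    · refine le_trans ?_ key
      have h1 : α / s₀ ^ J ≤ 2 * α := by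
        rw [div_le_iff₀ hsJ0]
        nlinarith
      have h2 := mul_le_mul_of_nonneg_right h1 (ha.nonneg J)
      have h3 : q * (κ * (a 0 - 2 * a J) * (1 - Real.cos x)) = α * a 0 - 2 * α * a J := by
        simp only [α]; ring
      linarith
    · rintro s ⟨hs0', hs1'⟩
      have hαβ : α - α / s₀ ^ J * s ^ J ≤ α := by
        have : 0 ≤ α / s₀ ^ J * s ^ J := by positivity
        linarith
      -- At `s = 0` only `k = ±1` contribute: `k = 0` also has truncated exponent `0`, but `u 0 =
      -- 0`.
      rcases hs0'.eq_or_lt with rfl | hs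
      · have hneg : cosCoeff M (-1) = cosCoeff M 1 := by simp [cosCoeff]
        rw [tsum_eq_sum (s := ({1, -1} : Finset ℤ)), Finset.sum_pair (by norm_num)]
        · have h1 : α ≤ 2 * (q * (cosCoeff M 1 * (1 - Real.cos x))) := by
            have h2 : 0 ≤ q * (cosCoeff M 1 * (1 - Real.cos x)) :=
              mul_nonneg hq0.le (mul_nonneg hb.le hcx)
            have h3 := mul_le_mul_of_nonneg_right (heatGap_le_one s₀) h2
            have h4 : α = 2 * (heatGap s₀ * (q * (cosCoeff M 1 * (1 - Real.cos x)))) := by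
              simp only [α, κ]; ring
            linarith
          refine hαβ.trans (h1.trans_eq ?_)
          simp [hu, hneg]
          ring
        · intro k hk
          simp only [Finset.mem_insert, Finset.mem_singleton, not_or] at hk
          rcases eq_or_ne k 0 with rfl | hk0
          · rw [hu0, zero_mul]
          · have h2 : 2 ≤ k.natAbs := by omega
            have : 2 ^ 2 ≤ k.natAbs ^ 2 := Nat.pow_le_pow_left h2 2
            rw [zero_pow (by omega), mul_zero]
      · have hqs0 : 0 < q * s := mul_pos hq0 hs
        have hqs : q * s ≤ s := mul_le_of_le_one_left hs.le hq1.le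
        have hqs1 : q * s < 1 := (mul_le_of_le_one_right hq0.le hs1').trans_lt hq1
        -- For `s > 0` the series is `s⁻¹` times the heat difference at parameter `q s`.
        have hterm : ∀ k : ℤ, u k * s ^ (k.natAbs ^ 2 - 1) = s⁻¹ *
            ((q * s) ^ (k.natAbs ^ 2) * (cosCoeff M k * (1 - Real.cos (k * x)))) := by
          intro k
          rcases eq_or_ne k 0 with rfl | hk
          · simp [hu0]
          · have h1 : 1 ≤ k.natAbs ^ 2 := Nat.one_le_pow _ _ (Int.natAbs_pos.2 hk)
            obtain ⟨n, hn⟩ : ∃ n, k.natAbs ^ 2 = n + 1 := ⟨k.natAbs ^ 2 - 1, by omega⟩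
            simp only [hu]
            rw [hn, Nat.add_sub_cancel, mul_pow, pow_succ s]
            field_simp
        have hlow := mul_le_mul_of_nonneg_left (le_heat_diff hM hqs0 hqs1 x) (inv_nonneg.2 hs.le)
        rw [← (hasSum_heat_diff hM hqs0.le hqs1 x).tsum_eq, ← tsum_mul_left,
          ← tsum_congr hterm] at hlow
        refine le_trans ?_ hlow
        have e : s⁻¹ * (2 * (q * s) * heatGap (q * s) * (cosCoeff M 1 * (1 - Real.cos x))) =
            heatGap (q * s) * (2 * q * (cosCoeff M 1 * (1 - Real.cos x))) := by
          field_simp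
        have hv : 0 ≤ 2 * q * (cosCoeff M 1 * (1 - Real.cos x)) :=
          mul_nonneg (by positivity) (mul_nonneg hb.le hcx)
        rw [e]
        rcases le_or_gt s s₀ with h | h
        · refine hαβ.trans (le_trans (le_of_eq ?_)
            (mul_le_mul_of_nonneg_right (heatGap_anti hqs0.le (hqs.trans h) hs1) hv))
          simp only [α, κ]
          ring
        · refine le_trans ?_ (mul_nonneg (heatGap_pos _).le hv)
          have h1 : s₀ ^ J ≤ s ^ J := pow_le_pow_left₀ hs0.le h.le J
          have h2 := mul_le_mul_of_nonneg_left h1 (div_nonneg hα hsJ0.le)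
          rw [div_mul_cancel₀ _ hsJ0.ne'] at h2
          linarith
  have hl : Tendsto (fun q : ℝ => q * (κ * (a 0 - 2 * a J) * (1 - Real.cos x))) (𝓝[<] 1)
      (𝓝 (1 * (κ * (a 0 - 2 * a J) * (1 - Real.cos x)))) :=
    (tendsto_id.mono_left nhdsWithin_le_nhds).mul_const _
  have hr : Tendsto (fun q : ℝ => N 1 - N (Real.cos y) + C * (1 - q)) (𝓝[<] 1)
      (𝓝 (N 1 - N (Real.cos y) + C * (1 - 1))) :=
    (((tendsto_id.mono_left nhdsWithin_le_nhds).const_sub 1).const_mul C).const_add _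
  have := le_of_tendsto_of_tendsto hl hr
    (by filter_upwards [Ioo_mem_nhdsLT (zero_lt_one' ℝ)] with q hq using main q hq)
  simpa using this

/-! ### Fourier coefficients of a translated even profile -/

theorem fourierHat_comp_cos_sub {M : ℝ → ℝ} (hM : Monotone M) (κ : ℝ) (k : ℤ) :
    fourierHat (fun x => M (Real.cos (x - κ))) k =
      Complex.exp (-Complex.I * κ * k) * (cosCoeff M k : ℂ) := by
  have hF := hM.isBoundedMeasurable_comp_cos
  set G : ℝ → ℂ := fun z => (M (Real.cos z) : ℂ) * Complex.exp (-Complex.I * (z + κ : ℝ) * k) with hG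
  have hper : Function.Periodic G (2 * Real.pi) := by
    intro z
    have e : -Complex.I * ((z + 2 * Real.pi + κ : ℝ) : ℂ) * k =
        -Complex.I * (z + κ : ℝ) * k + ((-k : ℤ) : ℂ) * (2 * Real.pi * Complex.I) := by
      push_cast; ring
    simp only [hG, Real.cos_add_two_pi, e, Complex.exp_add, Complex.exp_int_mul_two_pi_mul_I,
      mul_one]
  have h1 : ∫ x in (-Real.pi)..Real.pi, (M (Real.cos (x - κ)) : ℂ) * Complex.exp (-Complex.I * x * k)
      = ∫ z in (-Real.pi)..Real.pi, G z := by
    have h2 := hper.intervalIntegral_add_eq (-Real.pi - κ) (-Real.pi)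
    rw [show -Real.pi - κ + 2 * Real.pi = Real.pi - κ by ring,
      show -Real.pi + 2 * Real.pi = Real.pi by ring,
      ← intervalIntegral.integral_comp_sub_right G κ] at h2
    rw [← h2]
    exact intervalIntegral.integral_congr fun x _ => by simp [hG]
  have h3 : ∀ z, G z = Complex.exp (-Complex.I * κ * k) *
      (((M (Real.cos z) * Real.cos (k * z) : ℝ) : ℂ) -
        Complex.I * ((M (Real.cos z) * Real.sin (k * z) : ℝ) : ℂ)) := by
    intro z
    have e : -Complex.I * ((z + κ : ℝ) : ℂ) * k =
        -Complex.I * κ * k + ((-(k * z) : ℝ) : ℂ) * Complex.I := by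
      push_cast; ring
    simp only [hG, e, Complex.exp_add, Complex.exp_mul_I, ← Complex.ofReal_cos,
      ← Complex.ofReal_sin, Real.cos_neg, Real.sin_neg]
    push_cast
    ring
  have hc := hF.mul (isBoundedMeasurable_cos_int_mul k)
  have hs : IsBoundedMeasurable fun z => M (Real.cos z) * Real.sin (k * z) :=
    hF.mul (isBoundedMeasurable_sin.comp (by fun_prop))
  have hint : ∀ {f : ℝ → ℝ}, IsBoundedMeasurable f →
      IntervalIntegrable (fun z => (f z : ℂ)) volume (-Real.pi) Real.pi := fun hf =>
    ⟨(hf.intervalIntegrable _ _).1.ofReal, (hf.intervalIntegrable _ _).2.ofReal⟩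
  have h0 : mean (fun z => M (Real.cos z) * Real.sin (k * z)) = 0 :=
    mean_eq_zero_of_odd fun z => by simp
  have h0' : ∫ z in (-Real.pi)..Real.pi, M (Real.cos z) * Real.sin (k * z) = 0 := by
    rwa [mean, mul_eq_zero_iff_left (by positivity)] at h0
  rw [fourierHat_eq, h1]
  simp_rw [h3]
  rw [intervalIntegral.integral_const_mul, intervalIntegral.integral_sub
    (hint hc) ((hint hs).const_mul _),
    intervalIntegral.integral_const_mul, intervalIntegral.integral_ofReal,
    intervalIntegral.integral_ofReal, h0', cosCoeff, mean]
  push_cast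
  ring

theorem fourierHat_congr_ae {f g : ℝ → ℝ} (h : ∀ᵐ x : ℝ, f x = g x) (k : ℤ) :
    fourierHat f k = fourierHat g k := by
  rw [fourierHat_eq, fourierHat_eq]
  congr 1
  refine intervalIntegral.integral_congr_ae ?_
  filter_upwards [h] with x hx _
  rw [hx]

/-! ### Even profiles with a single crest -/

theorem apply_eq_apply_arccos_cos {ψ : ℝ → ℝ} (hp : Function.Periodic ψ (2 * Real.pi))
    (he : ∀ x, ψ (-x) = ψ x) (x : ℝ) : ψ x = ψ (Real.arccos (Real.cos x)) := by
  have h := Real.cos_arccos (Real.neg_one_le_cos x) (Real.cos_le_one x)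
  obtain ⟨k, hk | hk⟩ := Real.cos_eq_cos_iff.1 h
  · have := hp.int_mul k (Real.arccos (Real.cos x))
    rw [← this]
    congr 1
    linarith
  · have := hp.int_mul k (-Real.arccos (Real.cos x))
    rw [← he (Real.arccos _), ← this]
    congr 1
    linarith

/-- Without a crest in `(p, r)`, the three points fit in one interval between consecutive crests,
where the profile falls and then rises, so no interior value exceeds both outer ones. -/
theorem HasSingleCrest.exists_crest_mem_Ioo {φ : ℝ → ℝ} (hp : Function.Periodic φ (2 * Real.pi))
    {x₀ x₁ : ℝ} (ha : AntitoneOn φ (Icc x₀ x₁))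
    (hm : MonotoneOn φ (Icc x₁ (x₀ + 2 * Real.pi))) {p q r : ℝ} (hpq : p < q) (hqr : q < r)
    (hφp : φ p < φ q) (hφr : φ r < φ q) : ∃ k : ℤ, x₀ + k * (2 * Real.pi) ∈ Ioo p r := by
  obtain ⟨k, hk, -⟩ := existsUnique_add_zsmul_mem_Ico Real.two_pi_pos p x₀
  rw [zsmul_eq_mul] at hk
  by_contra! hno
  have hr : r ≤ x₀ + 2 * Real.pi - k * (2 * Real.pi) := by
    by_contra! hlt
    refine hno (-k + 1) ⟨?_, ?_⟩ <;> push_cast <;> linarith [hk.2]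
  have hs : ∀ z, φ z = φ (z + k * (2 * Real.pi)) := fun z => (hp.int_mul k z).symm
  rw [hs p, hs q] at hφp
  rw [hs r, hs q] at hφr
  rcases le_total (q + k * (2 * Real.pi)) x₁ with h | h
  · exact hφp.not_ge (ha ⟨hk.1, by linarith⟩ ⟨by linarith [hk.1], h⟩ (by linarith))
  · exact hφr.not_ge (hm ⟨h, by linarith⟩ ⟨by linarith, by linarith⟩ (by linarith))

/-- Two rises and falls within one period would place two distinct crest translates less than `2π`
apart. -/
theorem HasSingleCrest.not_alternating {φ : ℝ → ℝ} (hp : Function.Periodic φ (2 * Real.pi))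
    (h : HasSingleCrest φ) {p q r s : ℝ} (hpq : p < q) (hqr : q < r) (hrs : r < s)
    (hsp : s < p + 2 * Real.pi) (h1 : φ p < φ q) (h2 : φ r < φ q) (h3 : φ r < φ s)
    (h4 : φ p < φ s) : False := by
  obtain ⟨x₀, x₁, -, -, ha, hm⟩ := h
  obtain ⟨k, hk⟩ := exists_crest_mem_Ioo hp ha hm hpq hqr h1 h2
  obtain ⟨l, hl⟩ := exists_crest_mem_Ioo hp ha hm hrs hsp h3 (by rwa [hp p])
  have hpi := Real.two_pi_pos
  have hkl : (k : ℝ) < l := lt_of_mul_lt_mul_right (by linarith [hk.2, hl.1]) hpi.le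
  have hkl' : (k : ℝ) + 1 ≤ l := by exact_mod_cast Int.add_one_le_iff.2 (by exact_mod_cast hkl)
  have := mul_le_mul_of_nonneg_right hkl' hpi.le
  linarith [hk.1, hl.2]

theorem HasSingleCrest.monotoneOn_or_antitoneOn {φ : ℝ → ℝ}
    (hp : Function.Periodic φ (2 * Real.pi)) (h : HasSingleCrest φ) (he : ∀ x, φ (-x) = φ x) :
    MonotoneOn φ (Icc 0 Real.pi) ∨ AntitoneOn φ (Icc 0 Real.pi) := by
  by_contra! hno
  have hrefl : ∀ z, φ (2 * Real.pi - z) = φ z := fun z => by rw [← he z, ← hp (-z)]; congr 1; ring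
  -- Failure of both monotonicities gives a strict peak or dip at three points; reflection in `π`
  -- completes it to a forbidden alternation.
  obtain ⟨a, ha, b, hb, c, hc, hab, hbc, ⟨h1, h2⟩ | ⟨h1, h2⟩⟩ :=
    not_monotoneOn_not_antitoneOn_iff_exists_lt_lt.1 hno
  · refine h.not_alternating hp hab hbc (s := 2 * Real.pi - b) (by linarith [hc.2])
      (by linarith [ha.1]) h1 h2 ?_ ?_ <;> rwa [hrefl]
  · refine h.not_alternating hp (p := b) (q := c) (r := 2 * Real.pi - b) (s := 2 * Real.pi + a) hbc
      (by linarith [hc.2]) (by linarith [ha.1]) (by linarith) h2 ?_ ?_ ?_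
    · rwa [hrefl]
    · rwa [hrefl, add_comm, hp]
    · rwa [add_comm, hp]

theorem exists_monotone_of_antitoneOn {ψ : ℝ → ℝ} (hp : Function.Periodic ψ (2 * Real.pi))
    (he : ∀ x, ψ (-x) = ψ x) (ha : AntitoneOn ψ (Icc 0 Real.pi)) :
    ∃ M : ℝ → ℝ, Monotone M ∧ (∀ t, M t ∈ range ψ) ∧ ∀ x, ψ x = M (Real.cos x) :=
  ⟨fun t => ψ (Real.arccos t), fun _ _ hst => ha ⟨Real.arccos_nonneg _, Real.arccos_le_pi _⟩
    ⟨Real.arccos_nonneg _, Real.arccos_le_pi _⟩ (Real.antitone_arccos hst),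
    fun _ => mem_range_self _, apply_eq_apply_arccos_cos hp he⟩

/-- An even profile with a single crest is symmetric about the crest. -/
theorem HasSingleCrest.exists_monotone {φ : ℝ → ℝ} (hp : Function.Periodic φ (2 * Real.pi))
    (h : HasSingleCrest φ) (he : ∀ x, φ (-x) = φ x) :
    ∃ (κ : ℝ) (M : ℝ → ℝ), Monotone M ∧ (∀ t, M t ∈ range φ) ∧
      ∀ x, φ x = M (Real.cos (x - κ)) := by
  rcases h.monotoneOn_or_antitoneOn hp he with hm | ha
  · have hs : ∀ x, φ (x + Real.pi) = φ (Real.pi - x) := fun x => by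
      rw [← he, ← hp]; congr 1; ring
    obtain ⟨M, hM, hr, hφ⟩ := exists_monotone_of_antitoneOn (ψ := fun x => φ (x + Real.pi))
      (fun x => by simp only; rw [← hp (x + Real.pi)]; congr 1; ring)
      (fun x => by rw [hs x]; congr 1; ring)
      (fun x hx y hy hxy => by
        simp only [hs]
        exact hm ⟨by linarith [hy.2], by linarith [hy.1]⟩ ⟨by linarith [hx.2], by linarith [hx.1]⟩
          (by linarith))
    refine ⟨Real.pi, M, hM, fun t => ?_, fun x => ?_⟩
    · obtain ⟨x, hx⟩ := hr t
      exact ⟨_, hx⟩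
    · rw [← hφ, sub_add_cancel]
  · obtain ⟨M, hM, hr, hφ⟩ := exists_monotone_of_antitoneOn hp he ha
    exact ⟨0, M, hM, hr, fun x => by rw [sub_zero, hφ]⟩

/-! ### The corner at the crest -/

/-- At a strict corner a maximum is not differentiable. -/
theorem not_differentiableAt_of_corner {φ : ℝ → ℝ} {x δ : ℝ} (hmax : ∀ y, φ y ≤ φ x) (hδ : 0 < δ)
    (h : ∀ᶠ t in 𝓝[>] (0 : ℝ), δ * t ^ 2 ≤ (φ x - φ (x + t)) ^ 2) : ¬ DifferentiableAt ℝ φ x := by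
  intro hd
  have h0 := hd.hasDerivAt
  rw [(show IsLocalMax φ x from .of_forall hmax).hasDerivAt_eq_zero h0] at h0
  have h1 := (hasDerivAt_iff_tendsto_slope_zero.1 h0).mono_left
    (nhdsWithin_mono 0 (fun t (ht : 0 < t) => ht.ne') : 𝓝[>] (0 : ℝ) ≤ _)
  have h2 := h1.pow 2
  have h3 : δ ≤ 0 ^ 2 := by
    refine ge_of_tendsto h2 ?_
    filter_upwards [h, self_mem_nhdsWithin] with t ht (ht0 : 0 < t)
    have : (t⁻¹ • (φ (x + t) - φ x)) ^ 2 = (φ x - φ (x + t)) ^ 2 / t ^ 2 := by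
      rw [smul_eq_mul]; field_simp; ring
    rw [this, le_div_iff₀ (by positivity)]
    exact ht
  norm_num at h3
  linarith

/-- The equation identifies `L φ` almost everywhere with a translated profile; the common phase
`e^(-iκk)` cancels. -/
theorem cosCoeff_eq_of_isBoundedSolution {m : ℤ → ℝ} {c B κ : ℝ} {φ M : ℝ → ℝ}
    (h : IsBoundedSolution m c B φ) (hM : Monotone M) (hMφ : ∀ x, φ x = M (Real.cos (x - κ)))
    (hN : Monotone fun t => B + c ^ 2 / 4 - (c / 2 - M t) ^ 2) (k : ℤ) :
    cosCoeff (fun t => B + c ^ 2 / 4 - (c / 2 - M t) ^ 2) k = m k * cosCoeff M k := by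
  obtain ⟨-, -, L, ⟨-, -, hL⟩, heq⟩ := h
  have h1 := hL k
  have hLN : ∀ᵐ x : ℝ, L x = (fun t => B + c ^ 2 / 4 - (c / 2 - M t) ^ 2) (Real.cos (x - κ)) := by
    filter_upwards [heq] with x hx
    rw [hMφ] at hx
    linear_combination hx
  rw [fourierHat_congr_ae hLN, fourierHat_comp_cos_sub hN, funext hMφ,
    fourierHat_comp_cos_sub hM, mul_left_comm] at h1
  exact_mod_cast mul_left_cancel₀ (Complex.exp_ne_zero _) h1

theorem not_contDiffAt_crest {m : ℤ → ℝ} {c B : ℝ} {φ : ℝ → ℝ} {a : ℕ → ℝ}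
    (ha : IsCompletelyMonotone a) (hma : ∀ k : ℤ, k ≠ 0 → m k = a (k.natAbs ^ 2 - 1))
    (hdecay : ∀ ε > 0, ∃ j, a j < ε) (hφ : IsBoundedSolution m c B φ)
    (hnontrivial : ¬ ∃ a : ℝ, ∀ᵐ x : ℝ, φ x = a) (heven : ∀ x : ℝ, φ (-x) = φ x)
    (hcrest : HasSingleCrest φ) (hmax : ∀ x, φ x ≤ c / 2) {x : ℝ} (hx : φ x = c / 2) :
    ¬ ContDiffAt ℝ 1 φ x := by
  obtain ⟨κ, M, hM, hr, hMφ⟩ := hcrest.exists_monotone hφ.1 heven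
  have hMc : ∀ t, M t ≤ c / 2 := fun t => by
    obtain ⟨y, hy⟩ := hr t
    exact hy ▸ hmax y
  have hN : Monotone fun t => B + c ^ 2 / 4 - (c / 2 - M t) ^ 2 := fun s t hst =>
    sub_le_sub_left (pow_le_pow_left₀ (sub_nonneg.2 (hMc t)) (sub_le_sub_left (hM hst) _) 2) _
  have hnot : ¬ ∀ᵐ y, M (Real.cos y) = M 0 := fun hae => hnontrivial ⟨M 0, by
    have := (measurePreserving_sub_right volume κ).quasiMeasurePreserving.ae hae
    filter_upwards [this] with y hy
    rw [hMφ, hy]⟩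
  have hM1 : cosCoeff M 1 ≠ 0 := fun h => hnot (ae_eq_of_cosCoeff_one_eq_zero hM h)
  -- On `φ ≤ c/2` the square is injective, so a constant `L φ` would force a constant `φ`.
  have hN1 : cosCoeff (fun t => B + c ^ 2 / 4 - (c / 2 - M t) ^ 2) 1 ≠ 0 := fun h => hnot <| by
    filter_upwards [ae_eq_of_cosCoeff_one_eq_zero hN h] with y hy
    have := (pow_left_inj₀ (sub_nonneg.2 (hMc (Real.cos y))) (sub_nonneg.2 (hMc 0)) two_ne_zero).1
      (by linarith)
    linarith
  obtain ⟨ε, hε, hcorner⟩ := exists_mul_one_sub_cos_le hM hN ha hdecay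
    (fun k hk => by rw [cosCoeff_eq_of_isBoundedSolution hφ hM hMφ hN, hma k hk]) hM1 hN1
  have hM1c : M 1 = c / 2 := le_antisymm (hMc 1) (by
    rw [← hx, hMφ]; exact hM (Real.cos_le_one _))
  have hcor : ∀ y, 0 < y → y ≤ Real.pi →
      ε / (2 * Real.pi ^ 2) * y ^ 2 ≤ (c / 2 - M (Real.cos y)) ^ 2 := by
    intro y hy hyπ
    have h1 := hcorner y hy hyπ
    have h2 := Real.cos_le_one_sub_mul_cos_sq (x := y / 2)
      (by rw [abs_of_pos (by linarith)]; linarith)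
    have h3 := mul_le_mul_of_nonneg_left
      (by linarith : 2 / Real.pi ^ 2 * (y / 2) ^ 2 ≤ 1 - Real.cos (y / 2)) hε.le
    have h4 : ε / (2 * Real.pi ^ 2) * y ^ 2 = ε * (2 / Real.pi ^ 2 * (y / 2) ^ 2) := by
      have := Real.pi_ne_zero
      field_simp
    rw [hM1c] at h1
    linarith
  have hδ : 0 < ε / (2 * Real.pi ^ 2) := by have := Real.pi_pos; positivity
  -- The bound puts `φ` strictly below `c/2` wherever `cos (x - κ) ≠ 1`, so the given point is the
  -- centre of symmetry.
  have hcos : Real.cos (x - κ) = 1 := by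
    by_contra hne
    have hy : 0 < Real.arccos (Real.cos (x - κ)) :=
      Real.arccos_pos.2 (lt_of_le_of_ne (Real.cos_le_one _) hne)
    have h1 := hcor _ hy (Real.arccos_le_pi _)
    rw [Real.cos_arccos (Real.neg_one_le_cos _) (Real.cos_le_one _), ← hMφ, hx] at h1
    have : 0 < ε / (2 * Real.pi ^ 2) * Real.arccos (Real.cos (x - κ)) ^ 2 := by positivity
    linarith
  have hsin : Real.sin (x - κ) = 0 := by
    have := Real.sin_sq_add_cos_sq (x - κ)
    rw [hcos] at this
    exact pow_eq_zero_iff two_ne_zero |>.1 (by linarith)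
  refine fun hcd => not_differentiableAt_of_corner (hx ▸ hmax) hδ ?_
    (hcd.differentiableAt one_ne_zero)
  filter_upwards [Ioo_mem_nhdsGT Real.pi_pos] with t ht
  have e : φ (x + t) = M (Real.cos t) := by
    rw [hMφ, show x + t - κ = (x - κ) + t by ring, Real.cos_add, hcos, hsin]
    simp
  rw [e, hx]
  exact hcor t ht.1 ht.2.le

end SteadyWave

theorem mainTheorem4 (m : ℤ → ℝ) (hm : ∀ k : ℤ, m (-k) = m k) (c : ℝ) (hc : 0 < c) (φ : ℝ → ℝ)
    (hφ : (SteadyWave.AssumptionS m ∧ SteadyWave.IsBoundedSolution m c 0 φ) ∨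
      (SteadyWave.AssumptionH m ∧ SteadyWave.mean φ = 0 ∧
        SteadyWave.IsBoundedSolution m c (SteadyWave.mean (fun x => φ x ^ 2)) φ))
    (hnontrivial : ¬ ∃ a : ℝ, ∀ᵐ x : ℝ, φ x = a)
    (heven : ∀ x : ℝ, φ (-x) = φ x)
    (hcrest : SteadyWave.HasSingleCrest φ)
    (hmax : IsGreatest (Set.range φ) (c / 2)) :
    ¬ ContDiff ℝ 1 φ ∧ ∀ x : ℝ, φ x = c / 2 → ¬ ContDiffAt ℝ 1 φ x := by
  have hle : ∀ x, φ x ≤ c / 2 := fun x => hmax.2 (Set.mem_range_self x)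
  have key : ∀ x : ℝ, φ x = c / 2 → ¬ ContDiffAt ℝ 1 φ x := by
    intro x hx
    rcases hφ with ⟨hS, hsol⟩ | ⟨hH, -, hsol⟩
    · obtain ⟨a, ha, hma, hdecay⟩ := hS.exists_isCompletelyMonotone hm
      exact SteadyWave.not_contDiffAt_crest ha hma hdecay hsol hnontrivial heven hcrest hle hx
    · obtain ⟨a, ha, hma, hdecay⟩ := hH.exists_isCompletelyMonotone hm
      exact SteadyWave.not_contDiffAt_crest ha hma hdecay hsol hnontrivial heven hcrest hle hx
  obtain ⟨x, hx⟩ := hmax.1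
  exact ⟨fun h => key x hx h.contDiffAt, key⟩
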